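/- Let $g\ge 2$ be a fixed integer. For positive integers $k,\lambda$, a $(g,k;\lambda)$-difference matrix over $\mathbb Z_g=\mathbb Z/g\mathbb Z$ is a $k\times g\lambda$ matrix $D=[d_{i\ell}]$ with entries in $\mathbb Z_g$ such that for all $1\le i<j\le k$ the multiset $\{d_{i\ell}-d_{j\ell} : 1\le \ell\le g\lambda\}$ contains every element of $\mathbb Z_g$ exactly $\lambda$ times. Let $(k_n,\lambda_n)_{n\in\mathbb N}$ be a sequence of pairs of positive integers such that $k_n\ge 3$ for all $n$, $\lambda_n\to\infty$ as $n\to\infty$, and, if $g$ is even, every $\lambda_n$ is even. Suppose also that there is some $\varepsilon_0>0$ such that \[ k_n<\Bigl(\tfrac16-\varepsilon_0\Bigr)\frac{\log(\lambda_n g)}{\log g}\qquad\text{for all } n. \] Then, as $n\to\infty$, the number of $(g,k_n;\lambda_n)$-difference matrices over $\mathbb Z_g$ is \[ \frac{g^{\,k_n\lambda_n g+\frac{(3k_n-4)(k_n-1)}{4}}}{\sqrt{(2\pi\lambda_n)^{\binom{k_n}{2}(g-1)}}}\,\bigl[1+o(1)\bigr]. \] -/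

import Mathlib

/-- `IsDifferenceMatrix g k lam D`: the `k × gλ` matrix `D` with entries in the group `G`
(written additively, not assumed commutative) is a `(g, k; λ)`-difference matrix over `G`: `G` has
order `g`, and for any two rows `i < j` every element `a` of `G` occurs exactly `λ` times among the
differences `D i l - D j l`, where `l` runs through the `gλ` columns. -/
def IsDifferenceMatrix {G : Type*} [AddGroup G] [DecidableEq G] (g k lam : ℕ)
    (D : Matrix (Fin k) (Fin (g * lam)) G) : Prop :=
  Nat.card G = g ∧
    ∀ i j : Fin k, i < j → ∀ a : G,
      (Finset.univ.filter (fun l : Fin (g * lam) => D i l - D j l = a)).card = lam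

/-- The number of `(g, k; λ)`-difference matrices over the cyclic group `ℤ/gℤ`. -/
noncomputable def numDifferenceMatrices (g k lam : ℕ) : ℕ :=
  Set.ncard {D : Matrix (Fin k) (Fin (g * lam)) (ZMod g) | IsDifferenceMatrix g k lam D}

/-! A uniformly random matrix is read column by column as a random walk of `g * lam` steps: a column
`x` increments, for each pair of rows, the counter of its difference when that difference is
nonzero. A difference matrix is a walk ending at `(lam, ..., lam)`, so Fourier inversion on the
torus of dimension `k.choose 2 * (g - 1)` gives the count as an integral of `charSum ^ (g * lam)`
times a character (`numDifferenceMatrices_eq_integral`).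

The sum `charSum` has full modulus `g ^ k` exactly where every phase vanishes. These points are the
peaks given by balanced multipliers, that is, by cycles over `ZMod g` on the complete graph on the
rows; there are `g ^ (k.choose 2 - (k - 1))` of them (`card_isBalanced_mul`). The parity assumption
makes the integrand invariant under translation by a peak (`countIntegrand_add_peak`), so all peaks
contribute equally. A stability argument shows that a nearly maximal sum forces proximity to a peak
(`exists_isBalanced_close`), which bounds the integral elsewhere.

Near the origin, a second-order expansion replaces the integrand by a Gaussian. Distinct pairs of
rows are uncorrelated, so the covariance is block diagonal with blocks proportional to `I - J / g`,
where `J` is the all-ones matrix, and the Gaussian integral is explicit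
(`norm_setIntegral_countIntegrand_sub_le`, `integral_exp_quadForm_eq`).

With `x = lam * g` and box radius `x ^ (-2/5)`, the cubic error is a negative power of `x` up to
logarithms, while the exponent `x ^ (1/5)` governing the decay still beats the loss `g ^ k ≤ x ^
(1/6)`. -/

open MeasureTheory

/-! ### The walk of difference counts and its Fourier integral. -/

/-- The pairs `i < j` of row indices. -/
abbrev RowPair (k : ℕ) : Type := {p : Fin k × Fin k // p.1 < p.2}

/-- Coordinates of the random walk: a nonzero difference together with a pair of rows. -/
abbrev WalkCoord (g k : ℕ) : Type := {a : ZMod g // a ≠ 0} × RowPair k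

/-- The function on `ZMod g` attached to the pair of rows `e`, extended by `0` at `0`. -/
def edgeFun {M : Type*} [Zero M] {g k : ℕ} (t : WalkCoord g k → M) (e : RowPair k)
    (a : ZMod g) : M :=
  if h : a ≠ 0 then t (⟨a, h⟩, e) else 0

/-- The pairing of the dual variable `t` with the step of the walk given by the column `x`. -/
def phase {M : Type*} [AddCommMonoid M] {g k : ℕ} (t : WalkCoord g k → M)
    (x : Fin k → ZMod g) : M :=
  ∑ e : RowPair k, edgeFun t e (x e.1.1 - x e.1.2)

@[simp] lemma edgeFun_zero_right {M : Type*} [Zero M] {g k : ℕ} (t : WalkCoord g k → M)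
    (e : RowPair k) : edgeFun t e 0 = 0 := by simp [edgeFun]

lemma edgeFun_of_ne {M : Type*} [Zero M] {g k : ℕ} (t : WalkCoord g k → M)
    (e : RowPair k) (a : {a : ZMod g // a ≠ 0}) : edgeFun t e a = t (a, e) := by
  simp [edgeFun, a.2]

lemma edgeFun_add {M : Type*} [AddCommMonoid M] {g k : ℕ} (s t : WalkCoord g k → M)
    (e : RowPair k) (a : ZMod g) : edgeFun (s + t) e a = edgeFun s e a + edgeFun t e a := by
  by_cases h : a = 0 <;> simp [edgeFun, h]

lemma phase_add {M : Type*} [AddCommMonoid M] {g k : ℕ} (s t : WalkCoord g k → M)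
    (x : Fin k → ZMod g) : phase (s + t) x = phase s x + phase t x := by
  simp [phase, edgeFun_add, Finset.sum_add_distrib]

lemma edgeFun_eq_sum {M : Type*} [AddCommMonoid M] {g k : ℕ} [NeZero g] (t : WalkCoord g k → M)
    (e : RowPair k) (b : ZMod g) :
    edgeFun t e b = ∑ a : {a : ZMod g // a ≠ 0}, (if b = a then 1 else 0 : ℕ) • t (a, e) := by
  by_cases h : b = 0
  · subst h
    rw [edgeFun_zero_right]
    refine (Finset.sum_eq_zero fun a _ => ?_).symm
    rw [if_neg (Ne.symm a.2), zero_smul]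
  · rw [Finset.sum_eq_single ⟨b, h⟩]
    · simp [edgeFun, h]
    · intro a _ ha
      rw [if_neg (fun hb => ha (Subtype.ext hb.symm)), zero_smul]
    · simp

lemma phase_eq_sum {M : Type*} [AddCommMonoid M] {g k : ℕ} [NeZero g] (t : WalkCoord g k → M)
    (x : Fin k → ZMod g) :
    phase t x = ∑ c : WalkCoord g k,
      (if x c.2.1.1 - x c.2.1.2 = c.1 then 1 else 0 : ℕ) • t c := by
  rw [Fintype.sum_prod_type_right, phase]
  exact Finset.sum_congr rfl fun e _ => edgeFun_eq_sum t e _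

/-- The count of the difference `0` is determined by the others, since each pair of rows has `g *
lam` differences in total. Dropping it makes the covariance of the walk nondegenerate. -/
lemma isDifferenceMatrix_iff {g k lam : ℕ} [NeZero g] (D : Matrix (Fin k) (Fin (g * lam)) (ZMod g)) :
    IsDifferenceMatrix g k lam D ↔ ∀ c : WalkCoord g k,
      (Finset.univ.filter (fun l => D c.2.1.1 l - D c.2.1.2 l = c.1)).card = lam := by
  refine ⟨fun h c => h.2 _ _ c.2.2 _, fun h => ⟨by simp, fun i j hij a => ?_⟩⟩
  have hne : ∀ b : ZMod g, b ≠ 0 →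
      (Finset.univ.filter (fun l => D i l - D j l = b)).card = lam :=
    fun b hb => h (⟨b, hb⟩, ⟨(i, j), hij⟩)
  by_cases ha : a = 0
  · subst ha
    have htot : ∑ b : ZMod g, (Finset.univ.filter (fun l => D i l - D j l = b)).card = g * lam := by
      rw [← Finset.card_eq_sum_card_fiberwise (fun _ _ => Finset.mem_univ _)]
      simp
    rw [← Finset.add_sum_erase _ _ (Finset.mem_univ (0 : ZMod g)),
      Finset.sum_congr rfl (g := fun _ => lam) (fun b hb => hne b (Finset.ne_of_mem_erase hb)),
      Finset.sum_const, Finset.card_erase_of_mem (Finset.mem_univ _), Finset.card_univ,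
      ZMod.card, smul_eq_mul] at htot
    obtain ⟨m, rfl⟩ : ∃ m, g = m + 1 := ⟨g - 1, (Nat.succ_pred_eq_of_pos (NeZero.pos g)).symm⟩
    have h2 := htot.trans (Nat.succ_mul m lam)
    rw [add_tsub_cancel_right] at h2
    linarith
  · exact hne a ha

instance : IsProbabilityMeasure (volume : Measure UnitAddCircle) := ⟨by simp⟩

/-- Orthogonality of the characters of a torus. -/
lemma integral_toCircle_sum_zsmul {ι : Type*} [Fintype ι] (n : ι → ℤ) :
    ∫ t : ι → UnitAddCircle, (AddCircle.toCircle (∑ i, n i • t i) : ℂ) =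
      if n = 0 then 1 else 0 := by
  classical
  split_ifs with h
  · subst h; simp
  · obtain ⟨i, hi⟩ := Function.ne_iff.mp h
    -- Moving the `i`-th coordinate by half a period, `1 / (2 * n i)`, changes the sign of the
    -- character.
    refine integral_eq_zero_of_add_right_eq_neg
      (g := Pi.single i (((1 : ℝ) / 2 / n i : ℝ) : UnitAddCircle)) fun t => ?_
    have : ∑ j, n j • (t + (Pi.single i (((1 : ℝ) / 2 / n i : ℝ) : UnitAddCircle) :
          ι → UnitAddCircle)) j
        = ∑ j, n j • t j + ((1 / 2 : ℝ) : UnitAddCircle) := by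
      simp only [Pi.add_apply, smul_add, Finset.sum_add_distrib]
      congr 1
      rw [Finset.sum_eq_single i (fun j _ hj => by simp [Pi.single_eq_of_ne hj]) (by simp),
        Pi.single_eq_same, ← AddCircle.coe_zsmul, zsmul_eq_mul]
      congr 1
      have : (n i : ℝ) ≠ 0 := by exact_mod_cast hi
      field_simp
    rw [this, AddCircle.toCircle_add, Circle.coe_mul, AddCircle.toCircle_apply_mk]
    have : (Circle.exp (2 * Real.pi / 1 * (1 / 2)) : ℂ) = -1 := by
      rw [Circle.coe_exp, show 2 * Real.pi / 1 * (1 / 2) = Real.pi by ring, Complex.exp_pi_mul_I]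
    rw [this, mul_neg_one]

/-- The sum over all columns of the character of the walk. -/
noncomputable def charSum (g k : ℕ) [NeZero g] (t : WalkCoord g k → UnitAddCircle) : ℂ :=
  ∑ x : Fin k → ZMod g, (AddCircle.toCircle (phase t x) : ℂ)

/-- The Fourier integrand whose integral counts difference matrices. -/
noncomputable def countIntegrand (g k lam : ℕ) [NeZero g] (t : WalkCoord g k → UnitAddCircle) : ℂ :=
  charSum g k t ^ (g * lam) * (AddCircle.toCircle (-(lam • ∑ c, t c)) : ℂ)

lemma toCircle_sum {ι : Type*} (s : Finset ι) (f : ι → UnitAddCircle) :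
    AddCircle.toCircle (∑ i ∈ s, f i) = ∏ i ∈ s, AddCircle.toCircle (f i) := by
  classical
  induction s using Finset.induction_on with
  | empty => simp
  | insert a s ha ih => rw [Finset.sum_insert ha, Finset.prod_insert ha, AddCircle.toCircle_add, ih]

@[fun_prop] lemma continuous_edgeFun {M : Type*} [Zero M] [TopologicalSpace M] {g k : ℕ}
    (e : RowPair k) (a : ZMod g) :
    Continuous (fun t : WalkCoord g k → M => edgeFun t e a) := by
  unfold edgeFun
  split_ifs <;> fun_prop

@[fun_prop] lemma continuous_phase {M : Type*} [AddCommMonoid M] [TopologicalSpace M]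
    [ContinuousAdd M] {g k : ℕ} (x : Fin k → ZMod g) :
    Continuous (fun t : WalkCoord g k → M => phase t x) := by
  unfold phase
  fun_prop

lemma continuous_charSum (g k : ℕ) [NeZero g] : Continuous (charSum g k) := by
  unfold charSum
  have := @AddCircle.continuous_toCircle 1
  fun_prop

lemma continuous_countIntegrand (g k lam : ℕ) [NeZero g] :
    Continuous (countIntegrand g k lam) := by
  unfold countIntegrand
  have := @AddCircle.continuous_toCircle 1
  have := continuous_charSum g k
  fun_prop

/-- Expanding the power over all tuples of columns turns each matrix into one character whose
frequency is its vector of counts minus `lam`; orthogonality keeps the matrices with frequency zero.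
-/
theorem numDifferenceMatrices_eq_integral (g k lam : ℕ) [NeZero g] :
    (numDifferenceMatrices g k lam : ℂ) = ∫ t, countIntegrand g k lam t := by
  classical
  set n : (Fin (g * lam) → Fin k → ZMod g) → WalkCoord g k → ℤ := fun D c =>
    ((Finset.univ.filter (fun l => D l c.2.1.1 - D l c.2.1.2 = c.1)).card : ℤ) - lam with hn
  have hcount : (numDifferenceMatrices g k lam : ℂ) =
      ∑ D : Fin (g * lam) → Fin k → ZMod g, if n D = 0 then 1 else 0 := by
    rw [Finset.sum_boole, numDifferenceMatrices, ← Set.ncard_coe_finset]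
    congr 1
    refine Set.ncard_congr (fun D _ l i => D i l) (fun D hD => ?_) (fun D D' _ _ h => ?_)
      (fun D hD => ⟨fun i l => D l i, ?_, rfl⟩)
    · have := (isDifferenceMatrix_iff D).1 hD
      simpa [hn, funext_iff, sub_eq_zero] using this
    · ext i l
      exact congr_fun (congr_fun h l) i
    · refine (isDifferenceMatrix_iff _).2 ?_
      simpa [hn, funext_iff, sub_eq_zero] using hD
  rw [hcount]
  have hpt : ∀ t, countIntegrand g k lam t =
      ∑ D : Fin (g * lam) → Fin k → ZMod g, (AddCircle.toCircle (∑ c, n D c • t c) : ℂ) := by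
    intro t
    rw [countIntegrand, charSum, Fintype.sum_pow, Finset.sum_mul]
    refine Finset.sum_congr rfl fun D _ => ?_
    have : ∑ c, n D c • t c = ∑ l, phase t (D l) + -(lam • ∑ c, t c) := by
      simp_rw [phase_eq_sum]
      rw [Finset.sum_comm, Finset.smul_sum, ← Finset.sum_neg_distrib, ← Finset.sum_add_distrib]
      refine Finset.sum_congr rfl fun c _ => ?_
      rw [← Finset.sum_smul, Finset.sum_boole, hn, sub_smul, sub_eq_add_neg]
      simp
    rw [this, AddCircle.toCircle_add, toCircle_sum]
    rw [Circle.coe_mul]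
    exact congrArg (· * _) (map_prod Circle.coeHom _ _).symm
  simp_rw [hpt]
  rw [integral_finsetSum]
  · exact Finset.sum_congr rfl fun D _ => (integral_toCircle_sum_zsmul _).symm
  · intro D _
    have := @AddCircle.continuous_toCircle 1
    exact Continuous.integrable_of_hasCompactSupport (by fun_prop)
      (HasCompactSupport.of_compactSpace _)

/-! ### Stability: nearly maximal sums and approximate homomorphisms. -/

lemma AddCircle.exists_coe_eq_abs_eq_norm (t : UnitAddCircle) :
    ∃ r : ℝ, (r : UnitAddCircle) = t ∧ |r| = ‖t‖ := by
  induction t using QuotientAddGroup.induction_on with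
  | H x =>
    refine ⟨x - round x, ?_, UnitAddCircle.norm_eq.symm⟩
    rw [AddCircle.coe_sub, sub_eq_self]
    exact (AddCircle.coe_eq_zero_iff 1).2 ⟨round x, by simp⟩

lemma UnitAddCircle.norm_coe_le (r : ℝ) : ‖(r : UnitAddCircle)‖ ≤ |r| := by
  rw [UnitAddCircle.norm_eq]
  simpa using round_le r 0

lemma UnitAddCircle.eq_zero_of_nsmul_eq_zero {g : ℕ} [NeZero g] {z : UnitAddCircle}
    (h : g • z = 0)
    (hz : g * ‖z‖ < 1) : z = 0 := by
  obtain ⟨r, rfl, hr⟩ := AddCircle.exists_coe_eq_abs_eq_norm z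
  rw [← AddCircle.coe_nsmul, AddCircle.coe_eq_zero_iff] at h
  obtain ⟨n, hn⟩ := h
  rw [zsmul_eq_mul, mul_one, nsmul_eq_mul] at hn
  rw [← hr, ← Nat.abs_cast, ← abs_mul, ← hn] at hz
  have : n = 0 := Int.abs_lt_one_iff.1 (by exact_mod_cast hz)
  subst this
  have hr0 : r = 0 := (mul_eq_zero.1 (by simpa using hn.symm : (g : ℝ) * r = 0)).resolve_left
    (NeZero.ne _)
  simp [hr0]

/-- The chord has length `2 * |sin (π r)|`, and Jordan's inequality bounds the sine from below. -/
lemma four_mul_norm_le_norm_toCircle_sub_one (t : UnitAddCircle) :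
    4 * ‖t‖ ≤ ‖(AddCircle.toCircle t : ℂ) - 1‖ := by
  obtain ⟨r, rfl, hr⟩ := AddCircle.exists_coe_eq_abs_eq_norm t
  have hr2 : |r| ≤ 1 / 2 := by
    have := AddCircle.norm_le_half_period (x := (r : UnitAddCircle)) (p := 1) one_ne_zero
    rw [hr]; simpa using this
  rw [← hr, AddCircle.toCircle_apply_mk, Circle.coe_exp, mul_comm _ Complex.I,
    Complex.norm_exp_I_mul_ofReal_sub_one]
  have h1 : 2 * Real.pi / 1 * r / 2 = Real.pi * r := by ring
  rw [h1, norm_mul, Real.norm_eq_abs, Real.norm_eq_abs, abs_two]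
  have h2 := Real.mul_abs_le_abs_sin (x := Real.pi * r) (by
    rw [abs_mul, abs_of_pos Real.pi_pos]; nlinarith [Real.pi_pos])
  rw [abs_mul, abs_of_pos Real.pi_pos] at h2
  have h3 : 2 / Real.pi * (Real.pi * |r|) = 2 * |r| := by field_simp
  linarith

/-- An approximate homomorphism from `ZMod g` to the circle is close to a homomorphism. -/
lemma exists_toAddCircle_mul_close {g : ℕ} [NeZero g] {f : ZMod g → UnitAddCircle} {ε : ℝ}
    (hf0 : f 0 = 0) (hf : ∀ a b, ‖f (a - b) - f a - f (-b)‖ ≤ ε) :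
    ∃ c : ZMod g, ∀ a, ‖f a - ZMod.toAddCircle (c * a)‖ ≤ 2 * g * ε := by
  have hε : 0 ≤ ε := (norm_nonneg _).trans (hf 0 0)
  have hg : (0 : ℝ) < g := by exact_mod_cast NeZero.pos g
  have hn : ∀ n : ℕ, ‖f n - n • f 1‖ ≤ n * ε := by
    intro n
    induction n with
    | zero => simp [hf0]
    | succ n ih =>
      have h1 := hf n (-1)
      rw [sub_neg_eq_add, neg_neg] at h1
      have h2 : f ((n + 1 : ℕ) : ZMod g) - (n + 1) • f 1
          = (f (n + 1) - f n - f 1) + (f n - n • f 1) := by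
        rw [add_smul, one_smul]; push_cast; abel
      rw [h2]
      refine (norm_add_le _ _).trans ?_
      push_cast
      linarith
  -- `g • f 1` is within `g * ε` of `f g = f 0 = 0`, so subtracting `r / g` from `f 1` gives a
  -- `g`-torsion point, whose multiples form the homomorphism.
  obtain ⟨r, hr, hrn⟩ := AddCircle.exists_coe_eq_abs_eq_norm (g • f 1)
  have hrle : |r| ≤ g * ε := by
    have := hn g
    rw [CharP.cast_eq_zero, hf0, zero_sub, norm_neg] at this
    rwa [hrn]
  obtain ⟨m, -, hm⟩ := (AddCircle.nsmul_eq_zero_iff (p := (1 : ℝ)) (n := g) (NeZero.pos g)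
    (u := f 1 - ((r / g : ℝ) : UnitAddCircle))).1 (by
      rw [smul_sub, ← AddCircle.coe_nsmul, ← hr, nsmul_eq_mul, mul_div_cancel₀ _ hg.ne', sub_self])
  have hm' : ZMod.toAddCircle (m : ZMod g) = f 1 - ((r / g : ℝ) : UnitAddCircle) := by
    rw [← hm, ZMod.toAddCircle_natCast, mul_one]
  refine ⟨m, fun a => ?_⟩
  obtain ⟨n, hng, rfl⟩ : ∃ n : ℕ, n < g ∧ (n : ZMod g) = a := ⟨a.val, ZMod.val_lt a, by simp⟩
  have h1 : ZMod.toAddCircle ((m : ZMod g) * (n : ZMod g)) = n • (f 1 - ((r / g : ℝ) : UnitAddCircle)) := by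
    rw [← hm', ← map_nsmul, nsmul_eq_mul, mul_comm]
  have h2 : f n - ZMod.toAddCircle ((m : ZMod g) * (n : ZMod g))
      = (f n - n • f 1) + ((n * (r / g) : ℝ) : UnitAddCircle) := by
    rw [h1, smul_sub, ← AddCircle.coe_nsmul, nsmul_eq_mul]; abel
  rw [h2]
  have h3 : |n * (r / g)| ≤ n * ε := by
    rw [abs_mul, abs_div, Nat.abs_cast, Nat.abs_cast]
    gcongr
    rwa [div_le_iff₀ hg, mul_comm]
  have h4 : (n : ℝ) ≤ g := by exact_mod_cast hng.le
  calc _ ≤ n * ε + n * ε := (norm_add_le _ _).trans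
        (add_le_add (hn n) ((UnitAddCircle.norm_coe_le _).trans h3))
    _ ≤ 2 * g * ε := by nlinarith

/-- If the character sum is nearly of maximal size, all phases are nearly zero. -/
lemma norm_phase_le_of_lt_norm_charSum {g k : ℕ} [NeZero g] {t : WalkCoord g k → UnitAddCircle}
    {κ : ℝ} (hκ : 0 ≤ κ) (h : (g : ℝ) ^ k - 4 * κ ^ 2 < ‖charSum g k t‖) (x : Fin k → ZMod g) :
    ‖phase t x‖ ≤ κ := by
  classical
  have hz : phase t 0 = 0 := by simp [phase]
  by_cases hx : x = 0
  · subst hx; rw [hz, norm_zero]; exact hκ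
  set w : ℂ := (AddCircle.toCircle (phase t x) : ℂ) with hw
  have hw1 : ‖w‖ = 1 := Circle.norm_coe _
  -- Only the cancellation between the columns `x` and `0` is used; the remaining terms are bounded
  -- trivially.
  have hsum : ‖charSum g k t‖ ≤ ‖w + 1‖ + ((g : ℝ) ^ k - 2) := by
    have hsub : ({x, 0} : Finset (Fin k → ZMod g)) ⊆ Finset.univ := Finset.subset_univ _
    rw [charSum, ← Finset.sum_sdiff hsub, Finset.sum_pair hx, hz, AddCircle.toCircle_zero,
      Circle.coe_one, add_comm]
    refine (norm_add_le _ _).trans (add_le_add le_rfl ((norm_sum_le _ _).trans ?_))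
    have h2 : 2 ≤ Fintype.card (Fin k → ZMod g) := by
      rw [← Finset.card_pair hx]; exact Finset.card_le_univ _
    simp only [Circle.norm_coe, Finset.sum_const, nsmul_eq_mul, mul_one]
    rw [Finset.card_sdiff_of_subset hsub, Finset.card_pair hx, Finset.card_univ, Nat.cast_sub h2]
    simp
  have hpar : ‖w + 1‖ ^ 2 + ‖w - 1‖ ^ 2 = 4 := by
    have := parallelogram_law_with_norm ℝ w 1
    rw [hw1, norm_one] at this
    linarith
  have hch := four_mul_norm_le_norm_toCircle_sub_one (phase t x)
  rw [← hw] at hch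
  have hs : 2 - 4 * κ ^ 2 < ‖w + 1‖ := by linarith
  have h4 : ‖w - 1‖ ^ 2 ≤ (4 * κ) ^ 2 := by
    by_cases hk : 2 ≤ 4 * κ ^ 2
    · nlinarith [sq_nonneg ‖w + 1‖]
    · nlinarith [norm_nonneg (w + 1)]
  have h5 := abs_le_of_sq_le_sq h4 (by positivity)
  rw [abs_norm] at h5
  linarith

/-! ### Peaks and balanced multipliers. -/

/-- The point of the torus at which the walk has the character given by the multipliers `c`. -/
noncomputable def peak {g k : ℕ} [NeZero g] (c : RowPair k → ZMod g) (p : WalkCoord g k) :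
    UnitAddCircle := ZMod.toAddCircle (c p.2 * p.1.1)

lemma edgeFun_peak {g k : ℕ} [NeZero g] (c : RowPair k → ZMod g) (e : RowPair k) (a : ZMod g) :
    edgeFun (peak c) e a = ZMod.toAddCircle (c e * a) := by
  by_cases h : a = 0
  · simp [h]
  · simp [edgeFun, peak, h]

lemma phase_peak {g k : ℕ} [NeZero g] (c : RowPair k → ZMod g) (x : Fin k → ZMod g) :
    phase (peak c) x = ZMod.toAddCircle (∑ e : RowPair k, c e * (x e.1.1 - x e.1.2)) := by
  simp [phase, edgeFun_peak, map_sum]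

/-- The multipliers for which the character of the walk is trivial. -/
def IsBalanced {g k : ℕ} (c : RowPair k → ZMod g) : Prop :=
  ∀ x : Fin k → ZMod g, ∑ e : RowPair k, c e * (x e.1.1 - x e.1.2) = 0

/-- A mixed second difference of the phase in rows `i` and `j` isolates the function on that edge,
which is therefore additive up to `3 * κ` and close to a homomorphism. The resulting multipliers are
balanced because their pairing with any `x` is a `g`-torsion point of norm less than `1 / g`. -/
lemma exists_isBalanced_close {g k : ℕ} [NeZero g] {t : WalkCoord g k → UnitAddCircle} {κ : ℝ}
    (h : ∀ x, ‖phase t x‖ ≤ κ)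
    (hκ : g * (κ * (1 + 6 * g * Fintype.card (RowPair k))) < 1) :
    ∃ c : RowPair k → ZMod g, IsBalanced c ∧
      ∀ e a, ‖edgeFun t e a - ZMod.toAddCircle (c e * a)‖ ≤ 6 * g * κ := by
  classical
  have key : ∀ e : RowPair k, ∃ c : ZMod g, ∀ a,
      ‖edgeFun t e a - ZMod.toAddCircle (c * a)‖ ≤ 2 * g * (3 * κ) := by
    intro e
    refine exists_toAddCircle_mul_close (edgeFun_zero_right t e) fun a b => ?_
    obtain ⟨⟨i, j⟩, hij⟩ := e
    have hij' : i < j := hij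
    set e : RowPair k := ⟨(i, j), hij⟩ with he
    -- An edge missing `i` or `j` cancels, and only `(i, j)` meets both.
    have hmix : edgeFun t e (a - b) - edgeFun t e a - edgeFun t e (-b)
        = phase t (Pi.single i a + Pi.single j b) - phase t (Pi.single i a)
          - phase t (Pi.single j b) := by
      simp only [phase]
      rw [← Finset.sum_sub_distrib, ← Finset.sum_sub_distrib, Finset.sum_eq_single e]
      · simp [he, hij'.ne, hij'.ne']
      · rintro ⟨⟨p, q⟩, hpq⟩ - hne
        have hpq' : p < q := hpq
        simp only [Pi.add_apply]
        by_cases hi : p ≠ i ∧ q ≠ i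
        · simp [Pi.single_eq_of_ne hi.1, Pi.single_eq_of_ne hi.2]
        by_cases hj : p ≠ j ∧ q ≠ j
        · simp [Pi.single_eq_of_ne hj.1, Pi.single_eq_of_ne hj.2]
        exfalso
        apply hne
        have : p = i ∧ q = j := by
          by_contra hcon
          grind
        simp [he, this.1, this.2]
      · simp
    rw [hmix]
    refine (norm_sub_le _ _).trans ?_
    have := norm_sub_le (phase t (Pi.single i a + Pi.single j b)) (phase t (Pi.single i a))
    linarith [h (Pi.single i a + Pi.single j b), h (Pi.single i a), h (Pi.single j b)]
  choose c hc using key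
  have hc' : ∀ e a, ‖edgeFun t e a - ZMod.toAddCircle (c e * a)‖ ≤ 6 * g * κ :=
    fun e a => (hc e a).trans (by linarith)
  refine ⟨c, fun x => ?_, hc'⟩
  apply ZMod.toAddCircle_injective g
  rw [map_zero]
  refine UnitAddCircle.eq_zero_of_nsmul_eq_zero (g := g) ?_ ?_
  · rw [← map_nsmul, nsmul_eq_mul, CharP.cast_eq_zero, zero_mul, map_zero]
  · have h1 : ZMod.toAddCircle (∑ e : RowPair k, c e * (x e.1.1 - x e.1.2))
        = phase t x - ∑ e : RowPair k, (edgeFun t e (x e.1.1 - x e.1.2)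
          - ZMod.toAddCircle (c e * (x e.1.1 - x e.1.2))) := by
      rw [Finset.sum_sub_distrib, map_sum, phase]; abel
    rw [h1]
    refine lt_of_le_of_lt (mul_le_mul_of_nonneg_left ?_ (Nat.cast_nonneg _)) hκ
    refine (norm_sub_le _ _).trans ?_
    have h2 := norm_sum_le_of_le (Finset.univ : Finset (RowPair k))
      (fun e _ => hc' e (x e.1.1 - x e.1.2))
    rw [Finset.sum_const, Finset.card_univ, nsmul_eq_mul] at h2
    linarith [h x]

/-! ### Counting balanced multipliers. -/

/-- The linear functional `x ↦ ∑ c_{ij} (x_i - x_j)`. -/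
def pairing {g k : ℕ} (c : RowPair k → ZMod g) : (Fin k → ZMod g) →ₗ[ZMod g] ZMod g where
  toFun x := ∑ e : RowPair k, c e * (x e.1.1 - x e.1.2)
  map_add' x y := by
    rw [← Finset.sum_add_distrib]
    exact Finset.sum_congr rfl fun e _ => by simp only [Pi.add_apply]; ring
  map_smul' r x := by
    rw [smul_eq_mul, Finset.mul_sum]
    exact Finset.sum_congr rfl fun e _ => by simp only [Pi.smul_apply, smul_eq_mul, RingHom.id_apply]; ring

lemma isBalanced_iff_pairing_eq_zero {g k : ℕ} (c : RowPair k → ZMod g) :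
    IsBalanced c ↔ pairing c = 0 := by
  rw [LinearMap.ext_iff]; rfl

/-- The boundary of the edge weights `c` at the vertices other than `0`. -/
def boundary (g k : ℕ) [NeZero k] :
    (RowPair k → ZMod g) →+ ({v : Fin k // v ≠ 0} → ZMod g) where
  toFun c v := pairing c (Pi.single v.1 1)
  map_zero' := by ext v; simp [pairing]
  map_add' c d := by ext v; simp [pairing, add_mul, Finset.sum_add_distrib]

/-- Constant vectors pair to zero, so a boundary vanishing away from vertex `0` vanishes at `0` too.
-/
lemma mem_ker_boundary {g k : ℕ} [NeZero k] (c : RowPair k → ZMod g) :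
    c ∈ (boundary g k).ker ↔ IsBalanced c := by
  rw [isBalanced_iff_pairing_eq_zero, AddMonoidHom.mem_ker]
  refine ⟨fun h => ?_, fun h => by ext v; simp [boundary, h]⟩
  have hv : ∀ v : Fin k, v ≠ 0 → pairing c (Pi.single v 1) = 0 := fun v hv =>
    congr_fun h ⟨v, hv⟩
  have hsum : ∑ v, pairing c (Pi.single v 1) = 0 := by
    rw [← map_sum, Finset.univ_sum_single (fun _ : Fin k => (1 : ZMod g))]
    simp [pairing]
  rw [Finset.sum_eq_single 0 (fun v _ h0 => hv v h0) (by simp)] at hsum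
  refine LinearMap.pi_ext' fun v => LinearMap.ext_ring ?_
  by_cases h0 : v = 0
  · subst h0; simpa using hsum
  · simpa using hv v h0

lemma boundary_surjective (g k : ℕ) [NeZero k] : Function.Surjective (boundary g k) := by
  intro m
  -- Weights on the star at vertex `0` realise any prescribed boundary; the sign is due to `0` being
  -- the first endpoint of each star edge.
  refine ⟨fun e => if e.1.1 = 0 then -m ⟨e.1.2, (lt_of_le_of_lt (Fin.zero_le _) e.2).ne'⟩ else 0, ?_⟩
  ext ⟨v, hv⟩
  have hv0 : (0 : Fin k) < v := Fin.pos_iff_ne_zero.2 hv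
  change ∑ e : RowPair k, _ = _
  rw [Finset.sum_eq_single (⟨(0, v), hv0⟩ : RowPair k)]
  · simp [hv.symm]
  · rintro ⟨⟨p, q⟩, hpq⟩ - hne
    by_cases hp : p = 0
    · subst hp
      have : q ≠ v := fun h => hne (by subst h; rfl)
      simp [Pi.single_eq_of_ne this, Pi.single_eq_of_ne hv.symm]
    · simp [hp]
  · simp

lemma card_isBalanced_mul (g k : ℕ) [NeZero g] [NeZero k] :
    Nat.card {c : RowPair k → ZMod g // IsBalanced c} * g ^ (k - 1)
      = g ^ Fintype.card (RowPair k) := by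
  have h1 := (boundary g k).ker.card_mul_index
  rw [AddSubgroup.index_ker, AddMonoidHom.range_eq_top.2 (boundary_surjective g k)] at h1
  have h2 : Nat.card (boundary g k).ker = Nat.card {c : RowPair k → ZMod g // IsBalanced c} :=
    Nat.card_congr (Equiv.subtypeEquivRight mem_ker_boundary)
  rw [← h2]
  simpa [Nat.card_eq_fintype_card, Fintype.card_subtype_compl] using h1

lemma card_rowPair (k : ℕ) : Fintype.card (RowPair k) = k.choose 2 := by
  have h1 : Fintype.card (RowPair k) = ∑ j : Fin k, (Finset.Iio j).card := by
    rw [Fintype.card_congr (β := Σ j : Fin k, Finset.Iio j)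
      { toFun := fun p => ⟨p.1.2, p.1.1, Finset.mem_Iio.2 p.2⟩
        invFun := fun q => ⟨(q.2.1, q.1), Finset.mem_Iio.1 q.2.2⟩
        left_inv := fun _ => rfl
        right_inv := fun _ => rfl }, Fintype.card_sigma]
    exact Finset.sum_congr rfl fun _ _ => Fintype.card_coe _
  rw [h1]
  simp only [Fin.card_Iio]
  rw [Fin.sum_univ_eq_sum_range (fun i => i), Finset.sum_range_id, Nat.choose_two_right]

/-! ### Equal contributions of the peaks, and decay away from them. -/

/-- Negation permutes the nonzero residues, so twice their sum is zero. For odd `g`, `2` is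
invertible; for even `g`, the factor `2` comes from `lam`. This is where parity enters. -/
lemma natCast_mul_sum_nonzero_eq_zero {g lam : ℕ} [NeZero g] (heven : Even g → Even lam) :
    (lam : ZMod g) * ∑ a : {a : ZMod g // a ≠ 0}, (a : ZMod g) = 0 := by
  set S := ∑ a : {a : ZMod g // a ≠ 0}, (a : ZMod g) with hS
  have h2 : 2 * S = 0 := by
    have : S = -S := by
      rw [hS, ← Finset.sum_neg_distrib]
      exact Fintype.sum_equiv ((Equiv.neg (ZMod g)).subtypeEquiv (by simp)) _ _ (by simp)
    linear_combination this
  rcases Nat.even_or_odd g with hg | hg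
  · obtain ⟨m, rfl⟩ := heven hg
    push_cast
    linear_combination (m : ZMod g) * h2
  · obtain ⟨m, hm⟩ := hg
    have h3 : ((2 * m + 1 : ℕ) : ZMod g) = 0 := by rw [← hm]; simp
    push_cast at h3
    linear_combination (lam : ZMod g) * S * h3 - (lam : ZMod g) * m * h2

/-- Balance leaves every phase unchanged, and parity makes the character of the target point trivial
at the peak. -/
lemma countIntegrand_add_peak {g k lam : ℕ} [NeZero g] (heven : Even g → Even lam)
    {c : RowPair k → ZMod g} (hc : IsBalanced c) (t : WalkCoord g k → UnitAddCircle) :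
    countIntegrand g k lam (t + peak c) = countIntegrand g k lam t := by
  have h1 : charSum g k (t + peak c) = charSum g k t := by
    refine Finset.sum_congr rfl fun x _ => ?_
    rw [phase_add, phase_peak, hc x, map_zero, add_zero]
  have h2 : lam • ∑ p : WalkCoord g k, peak c p = 0 := by
    have : ∑ p : WalkCoord g k, peak c p
        = ZMod.toAddCircle ((∑ e, c e) * ∑ a : {a : ZMod g // a ≠ 0}, (a : ZMod g)) := by
      rw [Fintype.sum_prod_type_right, Finset.sum_mul_sum, map_sum]
      simp [peak, map_sum]
    rw [this, ← map_nsmul, nsmul_eq_mul, mul_left_comm, natCast_mul_sum_nonzero_eq_zero heven, mul_zero,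
      map_zero]
  unfold countIntegrand
  rw [h1]
  simp only [Pi.add_apply, Finset.sum_add_distrib, smul_add, h2, add_zero]

lemma integrable_countIntegrand (g k lam : ℕ) [NeZero g] :
    Integrable (countIntegrand g k lam) :=
  (continuous_countIntegrand g k lam).integrable_of_hasCompactSupport
    (HasCompactSupport.of_compactSpace _)

lemma setIntegral_closedBall_peak {g k lam : ℕ} [NeZero g] (heven : Even g → Even lam)
    {c : RowPair k → ZMod g} (hc : IsBalanced c) (δ : ℝ) :
    ∫ t in Metric.closedBall (peak c) δ, countIntegrand g k lam t
      = ∫ t in Metric.closedBall 0 δ, countIntegrand g k lam t := by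
  classical
  rw [← integral_indicator Metric.isClosed_closedBall.measurableSet,
    ← integral_indicator Metric.isClosed_closedBall.measurableSet,
    ← integral_add_right_eq_self
      ((Metric.closedBall (peak c) δ).indicator (countIntegrand g k lam)) (peak c)]
  refine integral_congr_ae (Filter.Eventually.of_forall fun t => ?_)
  simp only [Set.indicator_apply, mem_closedBall_iff_norm, add_sub_cancel_right, sub_zero,
    countIntegrand_add_peak heven hc]

lemma mem_closedBall_peak_iff {g k : ℕ} [NeZero g] {c : RowPair k → ZMod g} {δ : ℝ} (hδ : 0 ≤ δ)
    {t : WalkCoord g k → UnitAddCircle} :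
    t ∈ Metric.closedBall (peak c) δ ↔
      ∀ e a, ‖edgeFun t e a - ZMod.toAddCircle (c e * a)‖ ≤ δ := by
  rw [mem_closedBall_iff_norm, pi_norm_le_iff_of_nonneg hδ]
  refine ⟨fun h e a => ?_, fun h p => ?_⟩
  · by_cases ha : a = 0
    · subst ha; simpa using hδ
    · simpa [edgeFun, peak, ha] using h (⟨a, ha⟩, e)
  · have := h p.2 p.1.1
    rwa [edgeFun_of_ne] at this

lemma disjoint_closedBall_peak {g k : ℕ} [NeZero g] {c c' : RowPair k → ZMod g} {δ : ℝ}
    (hδ : 0 ≤ δ) (hg : 2 * g * δ < 1) (h : c ≠ c') :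
    Disjoint (Metric.closedBall (peak c) δ) (Metric.closedBall (peak c') δ) := by
  rw [Set.disjoint_left]
  intro t ht ht'
  rw [mem_closedBall_peak_iff hδ] at ht ht'
  apply h
  ext1 e
  -- The difference `1` already recovers the multiplier, and distinct `g`-torsion points are at
  -- least `1 / g > 2 * δ` apart.
  rw [← mul_one (c e), ← mul_one (c' e), ← sub_eq_zero, ← ZMod.toAddCircle_eq_zero]
  refine UnitAddCircle.eq_zero_of_nsmul_eq_zero (g := g) ?_ ?_
  · rw [← map_nsmul, nsmul_eq_mul, CharP.cast_eq_zero, zero_mul, map_zero]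
  · have h1 : ZMod.toAddCircle (c e * 1 - c' e * 1)
        = (edgeFun t e 1 - ZMod.toAddCircle (c' e * 1))
          - (edgeFun t e 1 - ZMod.toAddCircle (c e * 1)) := by
      rw [map_sub]; abel
    rw [h1]
    have h2 := (norm_sub_le (edgeFun t e 1 - ZMod.toAddCircle (c' e * 1))
      (edgeFun t e 1 - ZMod.toAddCircle (c e * 1))).trans (add_le_add (ht' e 1) (ht e 1))
    have hg0 : (0 : ℝ) ≤ g := Nat.cast_nonneg _
    nlinarith

/-- Contrapositive of the stability statements with `κ = δ / (6 * g)`, so that `4 * κ ^ 2 = δ ^ 2 /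
(9 * g ^ 2)`; dividing by `g ^ k` and using `1 - u ≤ exp (-u)` gives the exponential. -/
lemma norm_charSum_le_of_forall_notMem {g k : ℕ} [NeZero g] {δ : ℝ} (hδ : 0 ≤ δ)
    (hδ' : δ * (1 + 6 * g * Fintype.card (RowPair k)) < 6)
    {t : WalkCoord g k → UnitAddCircle}
    (ht : ∀ c : RowPair k → ZMod g, IsBalanced c → t ∉ Metric.closedBall (peak c) δ) :
    ‖charSum g k t‖ ≤ (g : ℝ) ^ k * Real.exp (-(δ ^ 2 / (9 * g ^ 2 * g ^ k))) := by
  have hg : (0 : ℝ) < g := by exact_mod_cast NeZero.pos g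
  by_contra! hcon
  have h1 : (g : ℝ) ^ k - 4 * (δ / (6 * g)) ^ 2 < ‖charSum g k t‖ := by
    refine lt_of_le_of_lt ?_ hcon
    have h2 := Real.add_one_le_exp (-(δ ^ 2 / (9 * g ^ 2 * g ^ k)))
    calc (g : ℝ) ^ k - 4 * (δ / (6 * g)) ^ 2
        = (g : ℝ) ^ k * (-(δ ^ 2 / (9 * g ^ 2 * g ^ k)) + 1) := by field_simp; ring
      _ ≤ _ := by gcongr
  obtain ⟨c, hc, hct⟩ := exists_isBalanced_close
    (norm_phase_le_of_lt_norm_charSum (by positivity) h1) (by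
      rw [← mul_assoc, show (g : ℝ) * (δ / (6 * g)) = δ / 6 by field_simp]
      linarith)
  refine ht c hc ((mem_closedBall_peak_iff hδ).2 fun e a => (hct e a).trans_eq ?_)
  field_simp

theorem norm_numDifferenceMatrices_sub_le {g k lam : ℕ} [NeZero g] (heven : Even g → Even lam)
    {δ : ℝ} (hδ : 0 ≤ δ) (hδg : 2 * g * δ < 1)
    (hδ' : δ * (1 + 6 * g * Fintype.card (RowPair k)) < 6) :
    ‖(numDifferenceMatrices g k lam : ℂ)
        - Nat.card {c : RowPair k → ZMod g // IsBalanced c}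
          * ∫ t in Metric.closedBall 0 δ, countIntegrand g k lam t‖
      ≤ (g : ℝ) ^ (k * (g * lam)) *
        Real.exp (-((g * lam : ℕ) * (δ ^ 2 / (9 * g ^ 2 * g ^ k)))) := by
  classical
  set U : Set (WalkCoord g k → UnitAddCircle) :=
    ⋃ c : {c : RowPair k → ZMod g // IsBalanced c}, Metric.closedBall (peak c.1) δ with hU
  have hUm : MeasurableSet U := MeasurableSet.iUnion fun _ =>
    Metric.isClosed_closedBall.measurableSet
  have hint := integrable_countIntegrand g k lam
  have hmain : ∫ t in U, countIntegrand g k lam t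
      = Nat.card {c : RowPair k → ZMod g // IsBalanced c}
          * ∫ t in Metric.closedBall 0 δ, countIntegrand g k lam t := by
    rw [hU, integral_iUnion_fintype (fun _ => Metric.isClosed_closedBall.measurableSet)
      (fun c c' h => disjoint_closedBall_peak hδ hδg (fun h' => h (Subtype.ext h')))
      (fun _ => hint.integrableOn)]
    rw [Finset.sum_congr rfl fun c _ => setIntegral_closedBall_peak heven c.2 δ]
    simp [Nat.card_eq_fintype_card]
  rw [numDifferenceMatrices_eq_integral, ← integral_add_compl hUm hint, hmain,
    add_sub_cancel_left]
  have hbd : ∀ t ∈ Uᶜ, ‖countIntegrand g k lam t‖ ≤ (g : ℝ) ^ (k * (g * lam)) *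
        Real.exp (-((g * lam : ℕ) * (δ ^ 2 / (9 * g ^ 2 * g ^ k)))) := by
    intro t ht
    rw [countIntegrand, norm_mul, Circle.norm_coe, mul_one, norm_pow, pow_mul (g : ℝ), ← mul_neg,
      Real.exp_nat_mul, ← mul_pow]
    refine pow_le_pow_left₀ (norm_nonneg _) (norm_charSum_le_of_forall_notMem hδ hδ' ?_) _
    intro c hc htc
    exact ht (Set.mem_iUnion.2 ⟨⟨c, hc⟩, htc⟩)
  refine (norm_setIntegral_le_of_norm_le_const (measure_lt_top _ _) hbd).trans ?_
  refine mul_le_of_le_one_right (by positivity) ?_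
  exact measureReal_le_one

/-! ### Mean and variance of one step of the walk. -/

/-- The column `x` with `s` added in row `v`. -/
def shiftCoord {g k : ℕ} (x : Fin k → ZMod g) (v : Fin k) (s : ZMod g) : Fin k → ZMod g :=
  x + Pi.single v s

@[simp] lemma shiftCoord_same {g k : ℕ} (x : Fin k → ZMod g) (v : Fin k) (s : ZMod g) :
    shiftCoord x v s v = x v + s := by simp [shiftCoord]

lemma shiftCoord_of_ne {g k : ℕ} (x : Fin k → ZMod g) {v w : Fin k} (h : w ≠ v) (s : ZMod g) :
    shiftCoord x v s w = x w := by simp [shiftCoord, h]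

lemma natCast_mul_sum_eq_sum_shift {g k : ℕ} [NeZero g] (F : (Fin k → ZMod g) → ℝ) (v : Fin k) :
    g * ∑ x, F x = ∑ x, ∑ s : ZMod g, F (shiftCoord x v s) := by
  have h : ∀ s : ZMod g, ∑ x, F (shiftCoord x v s) = ∑ x, F x := fun s =>
    Equiv.sum_comp (Equiv.addRight (Pi.single v s : Fin k → ZMod g)) F
  rw [Finset.sum_comm]
  simp_rw [h]
  simp

lemma sum_sub_shift_left {g k : ℕ} [NeZero g] (u : ZMod g → ℝ) (e : RowPair k)
    (x : Fin k → ZMod g) :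
    ∑ s : ZMod g, u ((shiftCoord x e.1.1 s) e.1.1 - (shiftCoord x e.1.1 s) e.1.2)
      = ∑ a, u a := by
  have : ∀ s : ZMod g, (shiftCoord x e.1.1 s) e.1.1
      - (shiftCoord x e.1.1 s) e.1.2 = s + (x e.1.1 - x e.1.2) := by
    intro s
    have := e.2.ne'
    rw [shiftCoord_same, shiftCoord_of_ne _ this]; ring
  simp_rw [this]
  exact Equiv.sum_comp (Equiv.addRight (x e.1.1 - x e.1.2)) u

lemma sum_sub_shift_right {g k : ℕ} [NeZero g] (u : ZMod g → ℝ) (e : RowPair k)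
    (x : Fin k → ZMod g) :
    ∑ s : ZMod g, u ((shiftCoord x e.1.2 s) e.1.1 - (shiftCoord x e.1.2 s) e.1.2)
      = ∑ a, u a := by
  have : ∀ s : ZMod g, (shiftCoord x e.1.2 s) e.1.1
      - (shiftCoord x e.1.2 s) e.1.2 = (x e.1.1 - x e.1.2) - s := by
    intro s
    have := e.2.ne
    rw [shiftCoord_same, shiftCoord_of_ne _ this]; ring
  simp_rw [this]
  exact Equiv.sum_comp (Equiv.subLeft (x e.1.1 - x e.1.2)) u

lemma natCast_mul_sum_edge {g k : ℕ} [NeZero g] (u : ZMod g → ℝ) (e : RowPair k) :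
    g * ∑ x : Fin k → ZMod g, u (x e.1.1 - x e.1.2) = (g : ℝ) ^ k * ∑ a, u a := by
  rw [natCast_mul_sum_eq_sum_shift _ e.1.1]
  simp_rw [sum_sub_shift_left u e]
  simp

/-- Differences along distinct edges are uncorrelated even when the edges share a vertex: some
endpoint of `e` is not on `e'`, and averaging over that row kills the factor of `e`. -/
lemma sum_edge_mul_edge_eq_zero {g k : ℕ} [NeZero g] {u u' : ZMod g → ℝ} {e e' : RowPair k}
    (hu : ∑ a, u a = 0) (h : e ≠ e') :
    ∑ x : Fin k → ZMod g, u (x e.1.1 - x e.1.2) * u' (x e'.1.1 - x e'.1.2) = 0 := by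
  have hg : (g : ℝ) ≠ 0 := NeZero.ne _
  refine (mul_eq_zero.1 (?_ : (g : ℝ) * _ = 0)).resolve_left hg
  by_cases hv : e.1.1 ≠ e'.1.1 ∧ e.1.1 ≠ e'.1.2
  · rw [natCast_mul_sum_eq_sum_shift _ e.1.1]
    refine Finset.sum_eq_zero fun x _ => ?_
    have h1 : ∀ s : ZMod g, (shiftCoord x e.1.1 s) e'.1.1
        - (shiftCoord x e.1.1 s) e'.1.2 = x e'.1.1 - x e'.1.2 := by
      intro s
      simp [shiftCoord_of_ne _ hv.1.symm, shiftCoord_of_ne _ hv.2.symm]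
    simp_rw [h1]
    rw [← Finset.sum_mul, sum_sub_shift_left, hu, zero_mul]
  · have hw : e.1.2 ≠ e'.1.1 ∧ e.1.2 ≠ e'.1.2 := by
      obtain ⟨⟨i, j⟩, hij⟩ := e
      obtain ⟨⟨i', j'⟩, hij'⟩ := e'
      have h1 : i < j := hij
      have h2 : i' < j' := hij'
      have h3 : ¬ (i = i' ∧ j = j') := fun h3 => h (by simp [h3.1, h3.2])
      simp only at hv ⊢
      grind
    rw [natCast_mul_sum_eq_sum_shift _ e.1.2]
    refine Finset.sum_eq_zero fun x _ => ?_
    have h1 : ∀ s : ZMod g, (shiftCoord x e.1.2 s) e'.1.1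
        - (shiftCoord x e.1.2 s) e'.1.2 = x e'.1.1 - x e'.1.2 := by
      intro s
      simp [shiftCoord_of_ne _ hw.1.symm, shiftCoord_of_ne _ hw.2.symm]
    simp_rw [h1]
    rw [← Finset.sum_mul, sum_sub_shift_right, hu, zero_mul]

/-- The pairing of `y` with the centred step of the walk. -/
noncomputable def centredPhase {g k : ℕ} [NeZero g] (y : WalkCoord g k → ℝ) (x : Fin k → ZMod g) :
    ℝ :=
  phase y x - (∑ c, y c) / g

/-- `g` times the variance of `centredPhase y`. -/
noncomputable def quadForm {g k : ℕ} [NeZero g] (y : WalkCoord g k → ℝ) : ℝ :=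
  ∑ e : RowPair k, (∑ a, y (a, e) ^ 2 - (∑ a, y (a, e)) ^ 2 / g)

/-- The contribution of one pair of rows to `centredPhase`. -/
noncomputable def centredEdge {g k : ℕ} [NeZero g] (y : WalkCoord g k → ℝ) (e : RowPair k)
    (a : ZMod g) : ℝ :=
  edgeFun y e a - (∑ b, y (b, e)) / g

lemma centredPhase_eq_sum {g k : ℕ} [NeZero g] (y : WalkCoord g k → ℝ) (x : Fin k → ZMod g) :
    centredPhase y x = ∑ e : RowPair k, centredEdge y e (x e.1.1 - x e.1.2) := by
  simp only [centredPhase, centredEdge, phase, Finset.sum_sub_distrib, Finset.sum_div,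
    Fintype.sum_prod_type_right]

lemma sum_edgeFun_comp {g k : ℕ} [NeZero g] (y : WalkCoord g k → ℝ) (e : RowPair k) (φ : ℝ → ℝ)
    (hφ : φ 0 = 0) : ∑ a, φ (edgeFun y e a) = ∑ a, φ (y (a, e)) := by
  rw [← Finset.add_sum_erase _ _ (Finset.mem_univ (0 : ZMod g)), edgeFun_zero_right, hφ, zero_add]
  rw [Finset.sum_subtype (p := fun a : ZMod g => a ≠ 0) (F := inferInstance) (Finset.univ.erase 0)
    (by simp)]
  simp_rw [edgeFun_of_ne]

lemma sum_centredEdge {g k : ℕ} [NeZero g] (y : WalkCoord g k → ℝ) (e : RowPair k) :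
    ∑ a, centredEdge y e a = 0 := by
  have hg : (g : ℝ) ≠ 0 := NeZero.ne _
  simp only [centredEdge, Finset.sum_sub_distrib]
  rw [sum_edgeFun_comp y e (fun r => r) rfl]
  simp [mul_div_cancel₀ _ hg]

lemma sum_centredEdge_sq {g k : ℕ} [NeZero g] (y : WalkCoord g k → ℝ) (e : RowPair k) :
    ∑ a, centredEdge y e a ^ 2 = ∑ a, y (a, e) ^ 2 - (∑ a, y (a, e)) ^ 2 / g := by
  have hg : (g : ℝ) ≠ 0 := NeZero.ne _
  simp only [centredEdge, sub_sq, Finset.sum_sub_distrib, Finset.sum_add_distrib]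
  rw [sum_edgeFun_comp y e (fun r => r ^ 2) (by simp), ← Finset.sum_mul, ← Finset.mul_sum,
    sum_edgeFun_comp y e (fun r => r) rfl]
  simp only [Finset.sum_const, Finset.card_univ, ZMod.card, nsmul_eq_mul]
  field_simp
  ring

lemma sum_centredPhase {g k : ℕ} [NeZero g] (y : WalkCoord g k → ℝ) :
    ∑ x : Fin k → ZMod g, centredPhase y x = 0 := by
  have hg : (g : ℝ) ≠ 0 := NeZero.ne _
  simp_rw [centredPhase_eq_sum]
  rw [Finset.sum_comm]
  refine Finset.sum_eq_zero fun e _ => ?_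
  have := natCast_mul_sum_edge (k := k) (centredEdge y e) e
  rw [sum_centredEdge, mul_zero] at this
  exact (mul_eq_zero.1 this).resolve_left hg

lemma sum_centredPhase_sq {g k : ℕ} [NeZero g] (y : WalkCoord g k → ℝ) :
    ∑ x : Fin k → ZMod g, centredPhase y x ^ 2 = (g : ℝ) ^ k * (quadForm y / g) := by
  have hg : (g : ℝ) ≠ 0 := NeZero.ne _
  simp_rw [centredPhase_eq_sum, sq, Finset.sum_mul_sum]
  rw [Finset.sum_comm, quadForm, Finset.sum_div, Finset.mul_sum]
  refine Finset.sum_congr rfl fun e _ => ?_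
  rw [Finset.sum_comm, Finset.sum_eq_single e
    (fun e' _ h => sum_edge_mul_edge_eq_zero (sum_centredEdge y e) h.symm) (by simp)]
  have := natCast_mul_sum_edge (k := k) (fun a => centredEdge y e a ^ 2) e
  rw [sum_centredEdge_sq] at this
  simp_rw [← sq]
  rw [mul_div_assoc', eq_div_iff hg, ← this, mul_comm]

lemma abs_centredPhase_le {g k : ℕ} [NeZero g] {y : WalkCoord g k → ℝ} {δ : ℝ}
    (hy : ∀ c, |y c| ≤ δ) (x : Fin k → ZMod g) :
    |centredPhase y x| ≤ Fintype.card (WalkCoord g k) * δ := by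
  have hg : (1 : ℝ) ≤ g := by exact_mod_cast NeZero.pos g
  have h0 : (0 : ℝ) ≤ 1 / g := by positivity
  have h1 : (1 : ℝ) / g ≤ 1 := by rw [div_le_one (by linarith)]; exact hg
  have h : centredPhase y x = ∑ c : WalkCoord g k,
      ((if x c.2.1.1 - x c.2.1.2 = c.1 then 1 else 0) - 1 / g) * y c := by
    rw [centredPhase, phase_eq_sum, Finset.sum_div, ← Finset.sum_sub_distrib]
    refine Finset.sum_congr rfl fun c _ => ?_
    split_ifs <;> simp <;> ring
  rw [h]
  refine (Finset.abs_sum_le_sum_abs _ _).trans ?_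
  rw [← nsmul_eq_mul, ← Finset.card_univ, ← Finset.sum_const]
  refine Finset.sum_le_sum fun c _ => ?_
  rw [abs_mul]
  refine (mul_le_of_le_one_left (abs_nonneg _) ?_).trans (hy c)
  rw [abs_le]
  split_ifs <;> constructor <;> linarith

/-- Cauchy–Schwarz over the `g - 1` nonzero residues: the least eigenvalue of `I - J / g` is `1 /
g`. -/
lemma sum_sq_div_le_quadForm {g k : ℕ} [NeZero g] (y : WalkCoord g k → ℝ) :
    (∑ c, y c ^ 2) / g ≤ quadForm y := by
  have hg : (0 : ℝ) < g := by exact_mod_cast NeZero.pos g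
  rw [Fintype.sum_prod_type_right, Finset.sum_div, quadForm]
  refine Finset.sum_le_sum fun e _ => ?_
  have h := sq_sum_le_card_mul_sum_sq (s := Finset.univ)
    (f := fun a : {a : ZMod g // a ≠ 0} => y (a, e))
  have hc : ((Finset.univ : Finset {a : ZMod g // a ≠ 0}).card : ℝ) = g - 1 := by
    rw [Finset.card_univ, Fintype.card_subtype_compl, ZMod.card, Fintype.card_subtype_eq,
      Nat.cast_sub (NeZero.pos g), Nat.cast_one]
  rw [hc] at h
  rw [le_sub_iff_add_le, ← add_div, div_le_iff₀ hg]
  linarith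

/-! ### The Gaussian integral of the covariance form. -/

/-- A square root of the form `quadForm`. -/
noncomputable def sqrtMatrix (g k : ℕ) [NeZero g] : Matrix (WalkCoord g k) (WalkCoord g k) ℝ :=
  Matrix.blockDiagonal fun _ : RowPair k =>
    (1 - Matrix.of fun _ _ => (1 - 1 / √g) / (g - 1))

lemma card_nonzero_zmod (g : ℕ) [NeZero g] :
    (Fintype.card {a : ZMod g // a ≠ 0} : ℝ) = g - 1 := by
  rw [Fintype.card_subtype_compl, ZMod.card, Fintype.card_subtype_eq,
      Nat.cast_sub (NeZero.pos g), Nat.cast_one]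

/-- Each block is a rank-one perturbation of the identity: it scales constants by `1 / √g` and fixes
vectors of sum zero. -/
lemma det_sqrtMatrix {g : ℕ} (k : ℕ) [NeZero g] (hg : 2 ≤ g) :
    (sqrtMatrix g k).det = (1 / √g) ^ Fintype.card (RowPair k) := by
  have hg1 : (g : ℝ) - 1 ≠ 0 := by
    have : (2 : ℝ) ≤ g := by exact_mod_cast hg
    linarith
  rw [sqrtMatrix, Matrix.det_blockDiagonal, Finset.prod_const, Finset.card_univ]
  congr 1
  have h : (1 - Matrix.of fun _ _ => (1 - 1 / √g) / (g - 1) :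
      Matrix {a : ZMod g // a ≠ 0} {a : ZMod g // a ≠ 0} ℝ)
      = 1 + Matrix.replicateCol Unit
          (fun _ : {a : ZMod g // a ≠ 0} => -((1 - 1 / √(g : ℝ)) / ((g : ℝ) - 1)))
        * Matrix.replicateRow Unit (fun _ : {a : ZMod g // a ≠ 0} => (1 : ℝ)) := by
    ext i j
    simp [Matrix.mul_apply, sub_eq_add_neg]
  rw [h, Matrix.det_one_add_replicateCol_mul_replicateRow]
  simp only [dotProduct, one_mul, Finset.sum_const, Finset.card_univ, nsmul_eq_mul,
    card_nonzero_zmod]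
  field_simp
  ring

lemma sqrtMatrix_mulVec {g k : ℕ} [NeZero g] (y : WalkCoord g k → ℝ) (c : WalkCoord g k) :
    (sqrtMatrix g k).mulVec y c = y c - (1 - 1 / √g) / (g - 1) * ∑ a, y (a, c.2) := by
  obtain ⟨a, e⟩ := c
  rw [Matrix.mulVec, dotProduct, Fintype.sum_prod_type_right, Finset.sum_eq_single e]
  · simp [sqrtMatrix, Matrix.blockDiagonal_apply, sub_mul, Finset.sum_sub_distrib, Matrix.one_apply,
      Finset.mul_sum]
  · intro e' _ h
    simp [sqrtMatrix, Matrix.blockDiagonal_apply, h.symm]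
  · simp

lemma sum_sq_sqrtMatrix_mulVec {g k : ℕ} [NeZero g] (hg : 2 ≤ g) (y : WalkCoord g k → ℝ) :
    ∑ c, (sqrtMatrix g k).mulVec y c ^ 2 = quadForm y := by
  have hg0 : (2 : ℝ) ≤ g := by exact_mod_cast hg
  have hg1 : (g : ℝ) - 1 ≠ 0 := by linarith
  rw [Fintype.sum_prod_type_right, quadForm]
  refine Finset.sum_congr rfl fun e _ => ?_
  simp only [sqrtMatrix_mulVec, sub_sq, Finset.sum_sub_distrib, Finset.sum_add_distrib]
  rw [← Finset.sum_mul, ← Finset.mul_sum]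
  simp only [Finset.sum_const, Finset.card_univ, nsmul_eq_mul, card_nonzero_zmod]
  have hs : √(g : ℝ) ^ 2 = g := Real.sq_sqrt (by linarith)
  have hs0 : √(g : ℝ) ≠ 0 := by positivity
  set S := ∑ a, y (a, e)
  set r := √(g : ℝ)
  rw [← hs] at hg1 ⊢
  field_simp
  ring

lemma integrable_exp_neg_mul_sum_sq {ι : Type*} [Fintype ι] {b : ℝ} (hb : 0 < b) :
    Integrable fun y : ι → ℝ => Real.exp (-b * ∑ i, y i ^ 2) := by
  simp_rw [Finset.mul_sum, Real.exp_sum]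
  exact Integrable.fintype_prod fun _ => integrable_exp_neg_mul_sq hb

lemma integral_exp_neg_mul_sum_sq {ι : Type*} [Fintype ι] (b : ℝ) :
    ∫ y : ι → ℝ, Real.exp (-b * ∑ i, y i ^ 2) = √(Real.pi / b) ^ Fintype.card ι := by
  simp_rw [Finset.mul_sum, Real.exp_sum]
  rw [integral_fintype_prod_volume_eq_pow (fun x : ℝ => Real.exp (-b * x ^ 2)), integral_gaussian]

lemma integrable_and_integral_exp_quadForm {g k : ℕ} [NeZero g] (hg : 2 ≤ g) {b : ℝ} (hb : 0 < b) :
    Integrable (fun y : WalkCoord g k → ℝ => Real.exp (-b * quadForm y)) ∧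
    ∫ y : WalkCoord g k → ℝ, Real.exp (-b * quadForm y)
      = √(Real.pi / b) ^ Fintype.card (WalkCoord g k) * √g ^ Fintype.card (RowPair k) := by
  classical
  have hs0 : √(g : ℝ) ≠ 0 := by positivity
  have hdet : (sqrtMatrix g k).det ≠ 0 := by
    rw [det_sqrtMatrix k hg]; positivity
  have hmap := Real.map_matrix_volume_pi_eq_smul_volume_pi hdet
  have hinv : |((sqrtMatrix g k).det)⁻¹| = √g ^ Fintype.card (RowPair k) := by
    rw [det_sqrtMatrix k hg, one_div, inv_pow, inv_inv, abs_of_nonneg (by positivity)]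
  rw [hinv] at hmap
  have hmeas : Measurable (Matrix.toLin' (sqrtMatrix g k)) :=
    (LinearMap.continuous_of_finiteDimensional _).measurable
  have hcomp : (fun y : WalkCoord g k → ℝ => Real.exp (-b * quadForm y))
      = (fun z => Real.exp (-b * ∑ c, z c ^ 2)) ∘ Matrix.toLin' (sqrtMatrix g k) := by
    ext y
    simp [Matrix.toLin'_apply, sum_sq_sqrtMatrix_mulVec hg]
  have hint := integrable_exp_neg_mul_sum_sq (ι := WalkCoord g k) hb
  have hint' : Integrable (fun z : WalkCoord g k → ℝ => Real.exp (-b * ∑ c, z c ^ 2))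
      (Measure.map (Matrix.toLin' (sqrtMatrix g k)) volume) := by
    rw [hmap]; exact hint.smul_measure ENNReal.ofReal_ne_top
  rw [hcomp]
  refine ⟨hint'.comp_measurable hmeas, ?_⟩
  have := integral_map hmeas.aemeasurable hint'.aestronglyMeasurable
  refine this.symm.trans ?_
  rw [hmap, integral_smul_measure, integral_exp_neg_mul_sum_sq,
    ENNReal.toReal_ofReal (by positivity), smul_eq_mul, mul_comm]

/-! ### Gaussian approximation of the integrand near the origin. -/

lemma norm_one_add_pow_sub_one_le (z : ℂ) (n : ℕ) :
    ‖(1 + z) ^ n - 1‖ ≤ Real.exp (n * ‖z‖) - 1 := by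
  have h : ‖(1 + z) ^ n - 1‖ ≤ (1 + ‖z‖) ^ n - 1 := by
    induction n with
    | zero => simp
    | succ n ih =>
      have h1 : (1 + z) ^ (n + 1) - 1 = ((1 + z) ^ n - 1) * (1 + z) + z := by ring
      have h2 : ‖1 + z‖ ≤ 1 + ‖z‖ := (norm_add_le _ _).trans_eq (by simp)
      have h3 : 0 ≤ (1 + ‖z‖) ^ n - 1 := (norm_nonneg _).trans ih
      rw [h1]
      calc _ ≤ ‖(1 + z) ^ n - 1‖ * ‖1 + z‖ + ‖z‖ := by
            rw [← norm_mul]; exact norm_add_le _ _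
        _ ≤ ((1 + ‖z‖) ^ n - 1) * (1 + ‖z‖) + ‖z‖ := by gcongr
        _ = _ := by ring
  refine h.trans (sub_le_sub_right ?_ _)
  rw [Real.exp_nat_mul]
  refine pow_le_pow_left₀ (by positivity) ?_ n
  linarith [Real.add_one_le_exp ‖z‖]

/-- Second-order expansion of a characteristic function. -/
lemma norm_sum_exp_sub_le {Ω : Type*} [Fintype Ω] {h : Ω → ℝ} {η q : ℝ} (hη : η ≤ 1 / 2)
    (hh : ∀ ω, |h ω| ≤ η) (h1 : ∑ ω, h ω = 0) (h2 : ∑ ω, h ω ^ 2 = Fintype.card Ω * q)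
    (hΩ : 0 < Fintype.card Ω) :
    ‖(∑ ω, Complex.exp (h ω * Complex.I)) / Fintype.card Ω - Real.exp (-(q / 2))‖ ≤ η ^ 3 := by
  have hn : (0 : ℝ) < Fintype.card Ω := by exact_mod_cast hΩ
  obtain ⟨ω₀⟩ := Fintype.card_pos_iff.1 hΩ
  have hη0 : 0 ≤ η := (abs_nonneg _).trans (hh ω₀)
  have hq0 : 0 ≤ q := by
    have : 0 ≤ Fintype.card Ω * q := h2 ▸ Finset.sum_nonneg fun _ _ => sq_nonneg _
    exact nonneg_of_mul_nonneg_right this hn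
  have hq : q ≤ η ^ 2 := by
    have : Fintype.card Ω * q ≤ Fintype.card Ω * η ^ 2 := by
      rw [← h2, ← nsmul_eq_mul, ← Finset.card_univ, ← Finset.sum_const]
      refine Finset.sum_le_sum fun ω _ => ?_
      rw [← sq_abs]
      exact pow_le_pow_left₀ (abs_nonneg _) (hh ω) 2
    exact le_of_mul_le_mul_left this hn
  have hpt : ∀ ω, ‖Complex.exp (h ω * Complex.I)
      - (1 + h ω * Complex.I - (h ω : ℂ) ^ 2 / 2)‖ ≤ 2 / 9 * η ^ 3 := by
    intro ω
    have hnorm : ‖(h ω * Complex.I : ℂ)‖ = |h ω| := by simp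
    -- The third-order remainder has constant `4 / (3! * 3) = 2 / 9`.
    have := Complex.exp_bound (x := h ω * Complex.I) (by rw [hnorm]; linarith [hh ω])
      (n := 3) (by norm_num)
    rw [hnorm] at this
    have hs : ∑ m ∈ Finset.range 3, (h ω * Complex.I : ℂ) ^ m / m.factorial
        = 1 + h ω * Complex.I - (h ω : ℂ) ^ 2 / 2 := by
      simp [Finset.sum_range_succ, Nat.factorial, mul_pow]
      ring
    rw [hs] at this
    refine this.trans ?_
    have h3 := pow_le_pow_left₀ (abs_nonneg _) (hh ω) 3
    norm_num [Nat.factorial]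
    linarith
  have hsum : ‖(∑ ω, Complex.exp (h ω * Complex.I)) / Fintype.card Ω - (1 - (q : ℂ) / 2)‖
      ≤ 2 / 9 * η ^ 3 := by
    have hnc : (Fintype.card Ω : ℂ) ≠ 0 := by exact_mod_cast hΩ.ne'
    have e1 : (∑ ω, Complex.exp (h ω * Complex.I)) / Fintype.card Ω - (1 - (q : ℂ) / 2)
        = (∑ ω, (Complex.exp (h ω * Complex.I)
          - (1 + h ω * Complex.I - (h ω : ℂ) ^ 2 / 2))) / Fintype.card Ω := by
      have c1 : ∑ ω, (h ω : ℂ) = 0 := by exact_mod_cast h1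
      have c2 : ∑ ω, (h ω : ℂ) ^ 2 = Fintype.card Ω * q := by exact_mod_cast h2
      simp only [Finset.sum_sub_distrib, Finset.sum_add_distrib, ← Finset.sum_mul,
        ← Finset.sum_div, c1, c2]
      simp only [Finset.sum_const, Finset.card_univ, nsmul_eq_mul]
      generalize ∑ ω, Complex.exp (h ω * Complex.I) = S
      field_simp
      ring
    rw [e1, norm_div, Complex.norm_natCast, div_le_iff₀ hn]
    refine (norm_sum_le_of_le _ fun ω _ => hpt ω).trans_eq ?_
    simp [mul_comm]
  have hexp : ‖(1 - (q : ℂ) / 2) - Real.exp (-(q / 2))‖ ≤ η ^ 3 / 4 := by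
    have hq2 : |-(q / 2)| ≤ 1 := by
      rw [abs_neg, abs_of_nonneg (by positivity)]; nlinarith
    have := Real.abs_exp_sub_one_sub_id_le hq2
    have e2 : (1 - (q : ℂ) / 2) - Real.exp (-(q / 2))
        = ((-(Real.exp (-(q / 2)) - 1 - -(q / 2)) : ℝ) : ℂ) := by push_cast; ring
    rw [e2, Complex.norm_real, norm_neg, Real.norm_eq_abs]
    refine this.trans ?_
    have h4 : q ^ 2 ≤ (η ^ 2) ^ 2 := pow_le_pow_left₀ hq0 hq 2
    have h5 : η ^ 4 ≤ η ^ 3 := by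
      have : η ^ 3 * η ≤ η ^ 3 * 1 := by gcongr; linarith
      nlinarith
    nlinarith
  have htri := norm_sub_le_norm_sub_add_norm_sub
    ((∑ ω, Complex.exp (h ω * Complex.I)) / Fintype.card Ω) (1 - (q : ℂ) / 2)
    (Real.exp (-(q / 2)))
  have : 0 ≤ η ^ 3 := by positivity
  linarith

/-- The error is kept relative to the Gaussian, so it can later be integrated against it. Since `q ≤
1`, the factor `exp (-(q / 2))` is at least `1 / 2`, whence `2 * η ^ 3`. -/
lemma norm_sum_exp_pow_sub_le {Ω : Type*} [Fintype Ω] {h : Ω → ℝ} {η q : ℝ} (hη : η ≤ 1 / 2)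
    (hh : ∀ ω, |h ω| ≤ η) (h1 : ∑ ω, h ω = 0) (h2 : ∑ ω, h ω ^ 2 = Fintype.card Ω * q)
    (hq : q ≤ 1) (hΩ : 0 < Fintype.card Ω) (N : ℕ) :
    ‖(∑ ω, Complex.exp (h ω * Complex.I)) ^ N
        - (Fintype.card Ω : ℝ) ^ N * Real.exp (-(N * (q / 2)))‖
      ≤ (Fintype.card Ω : ℝ) ^ N * Real.exp (-(N * (q / 2))) *
        (Real.exp (N * (2 * η ^ 3)) - 1) := by
  have hn : (0 : ℝ) < Fintype.card Ω := by exact_mod_cast hΩ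
  have hnc : (Fintype.card Ω : ℂ) ≠ 0 := by exact_mod_cast hΩ.ne'
  have hA := norm_sum_exp_sub_le hη hh h1 h2 hΩ
  set S := ∑ ω, Complex.exp (h ω * Complex.I)
  set B := Real.exp (-(q / 2)) with hB
  have hB0 : 0 < B := Real.exp_pos _
  have hBc : (B : ℂ) ≠ 0 := by exact_mod_cast hB0.ne'
  have hB2 : 1 / 2 ≤ B := by
    have := Real.add_one_le_exp (-(q / 2)); linarith
  set r : ℂ := S / Fintype.card Ω / B - 1 with hr
  have hS : S = Fintype.card Ω * B * (1 + r) := by rw [hr]; field_simp; ring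
  have hrn : ‖r‖ ≤ 2 * η ^ 3 := by
    have : r = (S / Fintype.card Ω - B) / B := by rw [hr]; field_simp
    rw [this, norm_div, Complex.norm_real, Real.norm_eq_abs, abs_of_pos hB0, div_le_iff₀ hB0]
    nlinarith [norm_nonneg (S / Fintype.card Ω - B)]
  have hBN : Real.exp (-(N * (q / 2))) = B ^ N := by
    rw [hB, ← Real.exp_nat_mul]; ring_nf
  have e : S ^ N - (Fintype.card Ω : ℝ) ^ N * Real.exp (-(N * (q / 2)))
      = (Fintype.card Ω : ℂ) ^ N * (B : ℂ) ^ N * ((1 + r) ^ N - 1) := by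
    rw [hS, hBN]; push_cast; ring
  rw [e, norm_mul, norm_mul, norm_pow, norm_pow, Complex.norm_natCast, Complex.norm_real,
    Real.norm_eq_abs, abs_of_pos hB0, hBN]
  gcongr
  refine (norm_one_add_pow_sub_one_le r N).trans ?_
  gcongr

lemma edgeFun_coe {g k : ℕ} (y : WalkCoord g k → ℝ) (e : RowPair k) (a : ZMod g) :
    edgeFun (fun c => (y c : UnitAddCircle)) e a = (edgeFun y e a : ℝ) := by
  by_cases h : a = 0 <;> simp [edgeFun, h]

lemma AddCircle.coe_finsetSum {ι : Type*} (s : Finset ι) (f : ι → ℝ) :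
    ((∑ i ∈ s, f i : ℝ) : UnitAddCircle) = ∑ i ∈ s, (f i : UnitAddCircle) :=
  map_sum (QuotientAddGroup.mk' (AddSubgroup.zmultiples (1 : ℝ))) f s

lemma phase_coe {g k : ℕ} (y : WalkCoord g k → ℝ) (x : Fin k → ZMod g) :
    phase (fun c => (y c : UnitAddCircle)) x = (phase y x : ℝ) := by
  simp only [phase, edgeFun_coe, AddCircle.coe_finsetSum]

/-- The target `lam` is the mean of each counter after `g * lam` steps, so its character is absorbed
by centring each step. -/
lemma countIntegrand_coe {g k lam : ℕ} [NeZero g] (y : WalkCoord g k → ℝ) :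
    countIntegrand g k lam (fun c => (y c : UnitAddCircle))
      = (∑ x : Fin k → ZMod g,
          Complex.exp ((2 * Real.pi * centredPhase y x : ℝ) * Complex.I)) ^ (g * lam) := by
  have hg : (g : ℂ) ≠ 0 := NeZero.ne _
  have h1 : charSum g k (fun c => (y c : UnitAddCircle))
      = (∑ x : Fin k → ZMod g, Complex.exp ((2 * Real.pi * centredPhase y x : ℝ) * Complex.I))
        * Complex.exp (2 * Real.pi * (∑ c, y c : ℝ) / g * Complex.I) := by
    rw [charSum, Finset.sum_mul]
    refine Finset.sum_congr rfl fun x _ => ?_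
    rw [phase_coe, AddCircle.toCircle_apply_mk, Circle.coe_exp, ← Complex.exp_add, centredPhase]
    congr 1
    push_cast
    ring
  have h2 : -(lam • ∑ c, (y c : UnitAddCircle)) = ((-(lam * ∑ c, y c) : ℝ) : UnitAddCircle) := by
    rw [← AddCircle.coe_finsetSum, ← AddCircle.coe_nsmul, nsmul_eq_mul, AddCircle.coe_neg]
  rw [countIntegrand, h1, h2, AddCircle.toCircle_apply_mk, Circle.coe_exp, mul_pow,
    ← Complex.exp_nat_mul, mul_assoc, ← Complex.exp_add]
  have : ((g * lam : ℕ) : ℂ) * (2 * Real.pi * (∑ c, y c : ℝ) / g * Complex.I)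
      + ((2 * Real.pi / 1 * -(lam * ∑ c, y c) : ℝ) : ℂ) * Complex.I = 0 := by
    push_cast
    field_simp
    ring
  rw [this, Complex.exp_zero, mul_one]

lemma norm_countIntegrand_sub_gaussian_le {g k lam : ℕ} [NeZero g] {y : WalkCoord g k → ℝ}
    {δ : ℝ} (hy : ∀ c, |y c| ≤ δ)
    (hδ : 2 * Real.pi * (Fintype.card (WalkCoord g k) * δ) ≤ 1 / 2) :
    ‖countIntegrand g k lam (fun c => (y c : UnitAddCircle))
        - ((g : ℝ) ^ (k * (g * lam)) * Real.exp (-(2 * Real.pi ^ 2 * lam) * quadForm y) : ℝ)‖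
      ≤ (g : ℝ) ^ (k * (g * lam)) * Real.exp (-(2 * Real.pi ^ 2 * lam) * quadForm y) *
        (Real.exp ((g * lam : ℕ) *
          (2 * (2 * Real.pi * (Fintype.card (WalkCoord g k) * δ)) ^ 3)) - 1) := by
  have hg : (g : ℝ) ≠ 0 := NeZero.ne _
  have hcard : (Fintype.card (Fin k → ZMod g) : ℝ) = (g : ℝ) ^ k := by simp
  have hcard0 : 0 < Fintype.card (Fin k → ZMod g) := Fintype.card_pos
  have hh : ∀ x, |2 * Real.pi * centredPhase y x|
      ≤ 2 * Real.pi * (Fintype.card (WalkCoord g k) * δ) := by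
    intro x
    rw [abs_mul, abs_of_pos Real.two_pi_pos]
    exact mul_le_mul_of_nonneg_left (abs_centredPhase_le hy x) Real.two_pi_pos.le
  have h1 : ∑ x : Fin k → ZMod g, 2 * Real.pi * centredPhase y x = 0 := by
    rw [← Finset.mul_sum, sum_centredPhase, mul_zero]
  have h2 : ∑ x : Fin k → ZMod g, (2 * Real.pi * centredPhase y x) ^ 2
      = Fintype.card (Fin k → ZMod g) * (4 * Real.pi ^ 2 * quadForm y / g) := by
    simp_rw [mul_pow]
    rw [← Finset.mul_sum, sum_centredPhase_sq, hcard]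
    ring
  have hq : 4 * Real.pi ^ 2 * quadForm y / g ≤ 1 := by
    have h3 : (Fintype.card (Fin k → ZMod g) : ℝ) * (4 * Real.pi ^ 2 * quadForm y / g)
        ≤ Fintype.card (Fin k → ZMod g) * 1 := by
      rw [← h2, ← nsmul_eq_mul, ← Finset.card_univ, ← Finset.sum_const]
      refine Finset.sum_le_sum fun x _ => ?_
      rw [← sq_abs]
      have := hh x
      exact pow_le_one₀ (abs_nonneg _) (by linarith)
    exact le_of_mul_le_mul_left h3 (by exact_mod_cast hcard0)
  have := norm_sum_exp_pow_sub_le hδ hh h1 h2 hq hcard0 (g * lam)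
  have he : -(((g * lam : ℕ) : ℝ) * (4 * Real.pi ^ 2 * quadForm y / g / 2))
      = -(2 * Real.pi ^ 2 * lam) * quadForm y := by
    push_cast; field_simp; ring
  rw [he, hcard] at this
  rw [countIntegrand_coe]
  simpa [pow_mul] using this

/-! ### From the torus to Euclidean space, and Gaussian tails. -/

lemma setIntegral_closedBall_unitAddCircle {ι : Type*} [Fintype ι] {F : (ι → UnitAddCircle) → ℂ}
    (hF : Continuous F) {δ : ℝ} (hδ : 0 ≤ δ) (hδ2 : δ < 1 / 2) :
    ∫ t in Metric.closedBall 0 δ, F t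
      = ∫ y : ι → ℝ in Metric.closedBall 0 δ, F (fun c => (y c : UnitAddCircle)) := by
  classical
  have hmp : MeasurePreserving (fun (y : ι → ℝ) (c : ι) => (y c : UnitAddCircle))
      (Measure.pi fun _ => volume.restrict (Set.Ioc (-(1 / 2) : ℝ) (-(1 / 2) + 1))) volume :=
    measurePreserving_pi _ _ fun _ => UnitAddCircle.measurePreserving_mk _
  have hmeas : MeasurableSet (Metric.closedBall (0 : ι → UnitAddCircle) δ) :=
    Metric.isClosed_closedBall.measurableSet
  rw [← integral_indicator hmeas, ← hmp.map_eq, integral_map hmp.measurable.aemeasurable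
    (hF.stronglyMeasurable.indicator hmeas).aestronglyMeasurable, ← Measure.restrict_pi_pi,
    ← volume_pi, ← integral_indicator (MeasurableSet.univ_pi fun _ => measurableSet_Ioc),
    ← integral_indicator Metric.isClosed_closedBall.measurableSet]
  refine integral_congr_ae (Filter.Eventually.of_forall fun y => ?_)
  have hiff : (y ∈ Set.univ.pi (fun _ : ι => Set.Ioc (-(1 / 2) : ℝ) (-(1 / 2) + 1)) ∧
      (fun c => (y c : UnitAddCircle)) ∈ Metric.closedBall (0 : ι → UnitAddCircle) δ)
      ↔ y ∈ Metric.closedBall (0 : ι → ℝ) δ := by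
    rw [mem_closedBall_zero_iff, mem_closedBall_zero_iff, pi_norm_le_iff_of_nonneg hδ,
      pi_norm_le_iff_of_nonneg hδ, Set.mem_univ_pi, ← forall_and]
    refine forall_congr' fun c => ⟨fun ⟨h1, h2⟩ => ?_, fun h => ?_⟩
    · rwa [(AddCircle.norm_coe_eq_abs_iff 1 one_ne_zero).2] at h2
      rw [abs_one, abs_le]
      constructor <;> linarith [h1.1, h1.2]
    · rw [Real.norm_eq_abs] at h
      have h' := abs_le.1 h
      exact ⟨⟨by linarith, by linarith⟩, (UnitAddCircle.norm_coe_le _).trans h⟩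
  simp only [Set.indicator_apply]
  by_cases hb : y ∈ Metric.closedBall (0 : ι → ℝ) δ
  · have := hiff.2 hb
    rw [if_pos hb, if_pos this.1, if_pos this.2]
  · rw [if_neg hb]
    by_cases h1 : y ∈ Set.univ.pi (fun _ : ι => Set.Ioc (-(1 / 2) : ℝ) (-(1 / 2) + 1))
    · rw [if_pos h1, if_neg fun h2 => hb (hiff.1 ⟨h1, h2⟩)]
    · rw [if_neg h1]

/-- Half of the exponent is bounded using `quadForm y ≥ δ ^ 2 / g` outside the box; the other half
is integrated over the whole space, at the cost of `√2` per dimension. -/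
lemma setIntegral_compl_closedBall_gaussian_le {g k lam : ℕ} [NeZero g] (hg : 2 ≤ g)
    (hlam : 0 < lam) {δ : ℝ} (hδ : 0 ≤ δ) :
    ∫ y : WalkCoord g k → ℝ in (Metric.closedBall 0 δ)ᶜ,
        Real.exp (-(2 * Real.pi ^ 2 * lam) * quadForm y)
      ≤ Real.exp (-(Real.pi ^ 2 * lam * (δ ^ 2 / g))) * √2 ^ Fintype.card (WalkCoord g k) *
        ∫ y : WalkCoord g k → ℝ, Real.exp (-(2 * Real.pi ^ 2 * lam) * quadForm y) := by
  have hg0 : (0 : ℝ) < g := by exact_mod_cast NeZero.pos g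
  have hl : (0 : ℝ) < lam := by exact_mod_cast hlam
  have hpi := Real.pi_pos
  obtain ⟨i1, v1⟩ := integrable_and_integral_exp_quadForm (k := k) hg
    (b := 2 * Real.pi ^ 2 * lam) (by positivity)
  obtain ⟨i2, v2⟩ := integrable_and_integral_exp_quadForm (k := k) hg
    (b := Real.pi ^ 2 * lam) (by positivity)
  have hv : √2 ^ Fintype.card (WalkCoord g k) *
      ∫ y : WalkCoord g k → ℝ, Real.exp (-(2 * Real.pi ^ 2 * lam) * quadForm y)
      = ∫ y : WalkCoord g k → ℝ, Real.exp (-(Real.pi ^ 2 * lam) * quadForm y) := by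
    rw [v1, v2, ← mul_assoc, ← mul_pow, ← Real.sqrt_mul zero_le_two]
    congr 3
    field_simp
  rw [mul_assoc (Real.exp _), hv, ← integral_const_mul]
  refine (setIntegral_mono_on i1.integrableOn (i2.const_mul _).integrableOn
    Metric.isClosed_closedBall.measurableSet.compl fun y hy => ?_).trans
    (setIntegral_le_integral (i2.const_mul _) (Filter.Eventually.of_forall fun y => by positivity))
  rw [← Real.exp_add, Real.exp_le_exp]
  have hQ : δ ^ 2 / g ≤ quadForm y := by
    refine le_trans ?_ (sum_sq_div_le_quadForm y)
    rw [Set.mem_compl_iff, mem_closedBall_zero_iff, pi_norm_le_iff_of_nonneg hδ] at hy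
    push Not at hy
    obtain ⟨c, hc⟩ := hy
    gcongr
    calc δ ^ 2 ≤ ‖y c‖ ^ 2 := by gcongr
      _ = y c ^ 2 := by simp
      _ ≤ _ := Finset.single_le_sum (f := fun c => y c ^ 2) (fun _ _ => sq_nonneg _)
        (Finset.mem_univ c)
  have := mul_le_mul_of_nonneg_left hQ (by positivity : 0 ≤ Real.pi ^ 2 * lam)
  linarith

theorem norm_setIntegral_countIntegrand_sub_le {g k lam : ℕ} [NeZero g] (hg : 2 ≤ g)
    (hlam : 0 < lam) {δ : ℝ} (hδ0 : 0 ≤ δ) (hδ2 : δ < 1 / 2)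
    (hδ : 2 * Real.pi * (Fintype.card (WalkCoord g k) * δ) ≤ 1 / 2) :
    ‖(∫ t in Metric.closedBall 0 δ, countIntegrand g k lam t)
        - ((g : ℝ) ^ (k * (g * lam)) *
          ∫ y : WalkCoord g k → ℝ, Real.exp (-(2 * Real.pi ^ 2 * lam) * quadForm y) : ℝ)‖
      ≤ (g : ℝ) ^ (k * (g * lam)) *
          (∫ y : WalkCoord g k → ℝ, Real.exp (-(2 * Real.pi ^ 2 * lam) * quadForm y)) *
        ((Real.exp ((g * lam : ℕ) *
            (2 * (2 * Real.pi * (Fintype.card (WalkCoord g k) * δ)) ^ 3)) - 1)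
          + Real.exp (-(Real.pi ^ 2 * lam * (δ ^ 2 / g))) *
            √2 ^ Fintype.card (WalkCoord g k)) := by
  have hl : (0 : ℝ) < lam := by exact_mod_cast hlam
  have hpi := Real.pi_pos
  obtain ⟨hint, -⟩ := integrable_and_integral_exp_quadForm (k := k) hg
    (b := 2 * Real.pi ^ 2 * lam) (by positivity)
  have htail := setIntegral_compl_closedBall_gaussian_le (k := k) hg hlam hδ0
  set G : (WalkCoord g k → ℝ) → ℝ := fun y => Real.exp (-(2 * Real.pi ^ 2 * lam) * quadForm y)
    with hG
  set P : ℝ := (g : ℝ) ^ (k * (g * lam)) with hP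
  set E : ℝ := Real.exp ((g * lam : ℕ) *
    (2 * (2 * Real.pi * (Fintype.card (WalkCoord g k) * δ)) ^ 3)) - 1 with hE
  have hP0 : 0 ≤ P := by positivity
  have hE0 : 0 ≤ E := by
    rw [hE, sub_nonneg]; exact Real.one_le_exp (by positivity)
  have hbox : MeasurableSet (Metric.closedBall (0 : WalkCoord g k → ℝ) δ) :=
    Metric.isClosed_closedBall.measurableSet
  have hcont : Continuous fun y : WalkCoord g k → ℝ =>
      countIntegrand g k lam (fun c => (y c : UnitAddCircle)) :=
    (continuous_countIntegrand g k lam).comp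
      (continuous_pi fun c => (AddCircle.continuous_mk' 1).comp (continuous_apply c))
  have hsplit : ∫ y, G y = (∫ y in Metric.closedBall 0 δ, G y)
      + ∫ y in (Metric.closedBall 0 δ)ᶜ, G y := (integral_add_compl hbox hint).symm
  have hbox_le : ∫ y in Metric.closedBall 0 δ, G y ≤ ∫ y, G y :=
    setIntegral_le_integral hint (Filter.Eventually.of_forall fun y => (Real.exp_pos _).le)
  have hlocal : ‖(∫ t in Metric.closedBall 0 δ, countIntegrand g k lam t)
      - ((P * ∫ y in Metric.closedBall 0 δ, G y : ℝ) : ℂ)‖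
      ≤ P * (∫ y in Metric.closedBall 0 δ, G y) * E := by
    rw [setIntegral_closedBall_unitAddCircle (continuous_countIntegrand g k lam) hδ0 hδ2,
      ← integral_const_mul, ← integral_complex_ofReal, ← integral_sub, ← integral_mul_const]
    · refine norm_integral_le_of_norm_le ((hint.const_mul P).mul_const E).integrableOn ?_
      refine (ae_restrict_iff' hbox).2 (Filter.Eventually.of_forall fun y hy => ?_)
      rw [mem_closedBall_zero_iff, pi_norm_le_iff_of_nonneg hδ0] at hy
      exact norm_countIntegrand_sub_gaussian_le hy hδ
    · exact hcont.continuousOn.integrableOn_compact (isCompact_closedBall 0 δ)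
    · exact (hint.const_mul P).ofReal.integrableOn
  have htri := norm_sub_le_norm_sub_add_norm_sub
    (∫ t in Metric.closedBall 0 δ, countIntegrand g k lam t)
    ((P * ∫ y in Metric.closedBall 0 δ, G y : ℝ) : ℂ) ((P * ∫ y, G y : ℝ) : ℂ)
  have h2 : ‖((P * ∫ y in Metric.closedBall 0 δ, G y : ℝ) : ℂ) - ((P * ∫ y, G y : ℝ) : ℂ)‖
      = P * ∫ y in (Metric.closedBall 0 δ)ᶜ, G y := by
    rw [← Complex.ofReal_sub, Complex.norm_real, hsplit, Real.norm_eq_abs]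
    have : 0 ≤ ∫ y in (Metric.closedBall 0 δ)ᶜ, G y :=
      integral_nonneg fun y => (Real.exp_pos _).le
    rw [mul_add, sub_add_cancel_left, abs_neg, abs_of_nonneg (by positivity)]
  rw [h2] at htri
  have h3 := mul_le_mul_of_nonneg_left htail hP0
  have h4 : P * (∫ y in Metric.closedBall 0 δ, G y) * E ≤ P * (∫ y, G y) * E := by gcongr
  calc _ ≤ P * (∫ y, G y) * E + P * (Real.exp (-(Real.pi ^ 2 * lam * (δ ^ 2 / g))) *
        √2 ^ Fintype.card (WalkCoord g k) * ∫ y, G y) := by linarith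
    _ = _ := by ring

/-! ### The main term and an explicit relative error. -/

/-- The Gaussian approximation to the number of difference matrices. -/
noncomputable def mainTerm (g k lam : ℕ) : ℝ :=
  (g : ℝ) ^ ((k : ℝ) * (lam : ℝ) * (g : ℝ) + (3 * (k : ℝ) - 4) * ((k : ℝ) - 1) / 4)
    / Real.sqrt ((2 * Real.pi * (lam : ℝ)) ^ (k.choose 2 * (g - 1)))

lemma card_walkCoord (g k : ℕ) [NeZero g] :
    Fintype.card (WalkCoord g k) = k.choose 2 * (g - 1) := by
  rw [Fintype.card_prod, card_rowPair, Fintype.card_subtype_compl, ZMod.card,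
    Fintype.card_subtype_eq, mul_comm]

lemma integral_exp_quadForm_eq {g k lam : ℕ} [NeZero g] (hg : 2 ≤ g) (hlam : 0 < lam) :
    ∫ y : WalkCoord g k → ℝ, Real.exp (-(2 * Real.pi ^ 2 * lam) * quadForm y)
      = √g ^ k.choose 2 / √((2 * Real.pi * lam) ^ (k.choose 2 * (g - 1))) := by
  have hl : (0 : ℝ) < lam := by exact_mod_cast hlam
  have hpi := Real.pi_pos
  rw [(integrable_and_integral_exp_quadForm (k := k) hg
    (b := 2 * Real.pi ^ 2 * lam) (by positivity)).2, card_walkCoord, card_rowPair]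
  have h1 : Real.pi / (2 * Real.pi ^ 2 * lam) = (2 * Real.pi * lam)⁻¹ := by field_simp
  have h2 : √((2 * Real.pi * lam) ^ (k.choose 2 * (g - 1)))
      = √(2 * Real.pi * lam) ^ (k.choose 2 * (g - 1)) := by
    rw [Real.sqrt_eq_iff_mul_self_eq (by positivity) (by positivity), ← mul_pow,
      Real.mul_self_sqrt (by positivity)]
  rw [h1, h2, Real.sqrt_inv, inv_pow]
  ring

/-- Apart from `k * lam * g`, the exponent of `g` collects `k.choose 2 - (k - 1)` from the peaks and
`k.choose 2 / 2` from the determinant, which sum to `(3k - 4)(k - 1) / 4`. -/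
lemma mainTerm_eq {g k lam : ℕ} [NeZero g] (hg : 2 ≤ g) (hk : 1 ≤ k) (hlam : 0 < lam) :
    mainTerm g k lam = Nat.card {c : RowPair k → ZMod g // IsBalanced c} *
      ((g : ℝ) ^ (k * (g * lam)) *
        ∫ y : WalkCoord g k → ℝ, Real.exp (-(2 * Real.pi ^ 2 * lam) * quadForm y)) := by
  have hg0 : (0 : ℝ) < g := by exact_mod_cast NeZero.pos g
  have : NeZero k := ⟨by omega⟩
  have hcard : (Nat.card {c : RowPair k → ZMod g // IsBalanced c} : ℝ)
      = (g : ℝ) ^ k.choose 2 / (g : ℝ) ^ (k - 1) := by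
    rw [eq_div_iff (by positivity), ← card_rowPair]
    exact_mod_cast card_isBalanced_mul g k
  rw [integral_exp_quadForm_eq hg hlam, hcard, mainTerm, mul_div_assoc', mul_div_assoc']
  congr 1
  rw [← Real.rpow_natCast _ (k.choose 2), ← Real.rpow_natCast _ (k - 1), ← Real.rpow_natCast,
    ← Real.rpow_natCast, ← Real.rpow_sub hg0, Real.sqrt_eq_rpow, ← Real.rpow_mul hg0.le,
    ← Real.rpow_add hg0, ← Real.rpow_add hg0]
  congr 1
  rw [Nat.cast_choose_two, Nat.cast_sub hk]
  push_cast
  ring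

theorem abs_div_mainTerm_sub_one_le {g k lam : ℕ} [NeZero g] (hg : 2 ≤ g) (hk : 1 ≤ k)
    (hlam : 0 < lam) (heven : Even g → Even lam) {δ : ℝ} (hδ0 : 0 ≤ δ)
    (hδg : 2 * g * δ < 1) (hδK : δ * (1 + 6 * g * k.choose 2) < 6)
    (hδ : 2 * Real.pi * ((k.choose 2 * (g - 1) : ℕ) * δ) ≤ 1 / 2) :
    |(numDifferenceMatrices g k lam : ℝ) / mainTerm g k lam - 1|
      ≤ (Real.exp ((g * lam : ℕ) *
            (2 * (2 * Real.pi * ((k.choose 2 * (g - 1) : ℕ) * δ)) ^ 3)) - 1)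
          + Real.exp (-(Real.pi ^ 2 * lam * (δ ^ 2 / g))) * √2 ^ (k.choose 2 * (g - 1))
          + √((2 * Real.pi * lam) ^ (k.choose 2 * (g - 1))) *
            Real.exp (-((g * lam : ℕ) * (δ ^ 2 / (9 * g ^ 2 * g ^ k)))) := by
  have hg2 : (2 : ℝ) ≤ g := by exact_mod_cast hg
  have hl : (0 : ℝ) < lam := by exact_mod_cast hlam
  have hpi := Real.pi_pos
  rw [← card_walkCoord] at hδ
  have h1 := norm_numDifferenceMatrices_sub_le (k := k) heven hδ0 hδg (by rwa [card_rowPair])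
  have h2 := norm_setIntegral_countIntegrand_sub_le (k := k) hg hlam hδ0 (by nlinarith) hδ
  rw [mainTerm_eq hg hk hlam]
  -- The product is `√g ^ k.choose 2`. With at least one peak, this lets the far contribution be
  -- divided by the main term.
  have hGauss : 1 ≤ √((2 * Real.pi * lam) ^ (k.choose 2 * (g - 1))) *
      ∫ y : WalkCoord g k → ℝ, Real.exp (-(2 * Real.pi ^ 2 * lam) * quadForm y) := by
    rw [integral_exp_quadForm_eq hg hlam, mul_div_cancel₀ _ (by positivity)]
    exact one_le_pow₀ (Real.one_le_sqrt.2 (by linarith))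
  rw [card_walkCoord] at h2
  set D := k.choose 2 * (g - 1)
  set G := ∫ y : WalkCoord g k → ℝ, Real.exp (-(2 * Real.pi ^ 2 * lam) * quadForm y)
  set R := √((2 * Real.pi * lam) ^ D)
  set P : ℝ := (g : ℝ) ^ (k * (g * lam))
  set J := ∫ t in Metric.closedBall 0 δ, countIntegrand g k lam t
  set E := Real.exp ((g * lam : ℕ) * (2 * (2 * Real.pi * (D * δ)) ^ 3)) - 1
    + Real.exp (-(Real.pi ^ 2 * lam * (δ ^ 2 / g))) * √2 ^ D
  set T := Real.exp (-((g * lam : ℕ) * (δ ^ 2 / (9 * g ^ 2 * g ^ k))))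
  have hH : (1 : ℝ) ≤ Nat.card {c : RowPair k → ZMod g // IsBalanced c} := by
    have : Nonempty {c : RowPair k → ZMod g // IsBalanced c} := ⟨0, fun x => by simp⟩
    exact_mod_cast Nat.card_pos
  set H : ℕ := Nat.card {c : RowPair k → ZMod g // IsBalanced c}
  have hP : 0 < P := by positivity
  have hR : 0 < R := by positivity
  have hG : 0 < G := by
    by_contra! hcon
    nlinarith
  have hT : 0 < T := Real.exp_pos _
  have hM : 0 < (H : ℝ) * (P * G) := by positivity
  have hdiff : |(numDifferenceMatrices g k lam : ℝ) - H * (P * G)|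
      ≤ P * T + H * (P * G * E) := by
    have e : (((numDifferenceMatrices g k lam : ℝ) - H * (P * G) : ℝ) : ℂ)
        = ((numDifferenceMatrices g k lam : ℂ) - H * J) + H * (J - (P * G : ℝ)) := by
      push_cast; ring
    rw [← Real.norm_eq_abs, ← Complex.norm_real, e]
    refine (norm_add_le _ _).trans (add_le_add h1 ?_)
    rw [norm_mul, Complex.norm_natCast]
    exact mul_le_mul_of_nonneg_left h2 (Nat.cast_nonneg _)
  rw [div_sub_one hM.ne', abs_div, abs_of_pos hM, div_le_iff₀ hM]
  refine hdiff.trans ?_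
  have h3 : P * T ≤ R * T * (H * (P * G)) := by
    have : P * T * 1 ≤ P * T * (H * (R * G)) := by
      gcongr
      nlinarith
    calc P * T = P * T * 1 := (mul_one _).symm
      _ ≤ _ := this
      _ = _ := by ring
  calc P * T + H * (P * G * E) ≤ R * T * (H * (P * G)) + H * (P * G * E) := by linarith
    _ = (E + R * T) * (H * (P * G)) := by ring

/-! ### Uniform asymptotics of the error. -/

lemma tendsto_log_pow_mul_rpow_neg (j : ℕ) {s : ℝ} (hs : 0 < s) :
    Filter.Tendsto (fun x : ℝ => Real.log x ^ j * x ^ (-s)) Filter.atTop (nhds 0) := by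
  have h := (isLittleO_log_rpow_rpow_atTop (j : ℝ) hs).tendsto_div_nhds_zero
  refine h.congr' ?_
  filter_upwards [Filter.eventually_gt_atTop 0] with x hx
  rw [Real.rpow_natCast, Real.rpow_neg hx.le, div_eq_mul_inv]

lemma tendsto_exp_log_poly_sub_rpow {s a b c : ℝ} (hs : 0 < s) (hc : 0 < c) :
    Filter.Tendsto (fun x : ℝ =>
      Real.exp (a * Real.log x ^ 3 + b * Real.log x ^ 2 - c * x ^ s)) Filter.atTop (nhds 0) := by
  refine Real.tendsto_exp_atBot.comp ?_
  have h1 := (((tendsto_log_pow_mul_rpow_neg 3 hs).const_mul a).add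
    ((tendsto_log_pow_mul_rpow_neg 2 hs).const_mul b)).sub_const c
  rw [mul_zero, mul_zero, add_zero, zero_sub] at h1
  refine ((tendsto_rpow_atTop hs).atTop_mul_neg (neg_lt_zero.2 hc) h1).congr' ?_
  filter_upwards [Filter.eventually_gt_atTop 0] with x hx
  rw [Real.rpow_neg hx.le]
  have : x ^ s ≠ 0 := (Real.rpow_pos_of_pos hx s).ne'
  field_simp

/-- An error bound depending only on `g` and the number `x` of columns. -/
noncomputable def errorBound (g x : ℝ) : ℝ :=
  (Real.exp (2 * (2 * Real.pi * g) ^ 3 * (Real.log x ^ 6 * x ^ (-(1 / 5) : ℝ))) - 1)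
    + Real.exp (0 * Real.log x ^ 3 + g * Real.log x ^ 2 - Real.pi ^ 2 / g ^ 2 * x ^ (1 / 5 : ℝ))
    + Real.exp (g * Real.log x ^ 3 + 2 * g * Real.log x ^ 2 - 1 / (9 * g ^ 2) * x ^ (1 / 30 : ℝ))

lemma tendsto_errorBound {g : ℝ} (hg : 0 < g) :
    Filter.Tendsto (errorBound g) Filter.atTop (nhds 0) := by
  have hpi := Real.pi_pos
  have h1 : Filter.Tendsto (fun x : ℝ =>
      Real.exp (2 * (2 * Real.pi * g) ^ 3 * (Real.log x ^ 6 * x ^ (-(1 / 5) : ℝ))) - 1)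
      Filter.atTop (nhds 0) := by
    have := ((tendsto_log_pow_mul_rpow_neg 6 (s := 1 / 5) (by norm_num)).const_mul
      (2 * (2 * Real.pi * g) ^ 3))
    rw [mul_zero] at this
    have := (Real.continuous_exp.tendsto 0).comp this
    simpa using this.sub_const 1
  have h2 := tendsto_exp_log_poly_sub_rpow (s := 1 / 5) (a := 0) (b := g)
    (c := Real.pi ^ 2 / g ^ 2) (by norm_num) (by positivity)
  have h3 := tendsto_exp_log_poly_sub_rpow (s := 1 / 30) (a := g) (b := 2 * g)
    (c := 1 / (9 * g ^ 2)) (by norm_num) (by positivity)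
  have h := (h1.add h2).add h3
  rw [add_zero, add_zero] at h
  exact h

lemma eventually_small_radius {g : ℝ} :
    ∀ᶠ x : ℝ in Filter.atTop, 1 ≤ x ∧ 2 * g * x ^ (-(2 / 5) : ℝ) < 1 ∧
      x ^ (-(2 / 5) : ℝ) * (1 + 6 * g * Real.log x ^ 2) < 6 ∧
      2 * Real.pi * (g * Real.log x ^ 2 * x ^ (-(2 / 5) : ℝ)) ≤ 1 / 2 := by
  have h0 := tendsto_log_pow_mul_rpow_neg 0 (s := 2 / 5) (by norm_num)
  have h2 := tendsto_log_pow_mul_rpow_neg 2 (s := 2 / 5) (by norm_num)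
  simp only [pow_zero, one_mul] at h0
  have t1 := h0.const_mul (2 * g)
  have t2 := h0.add (h2.const_mul (6 * g))
  have t3 := h2.const_mul (2 * Real.pi * g)
  simp only [mul_zero, add_zero] at t1 t2 t3
  filter_upwards [Filter.eventually_ge_atTop 1, t1.eventually_lt_const zero_lt_one,
    t2.eventually_lt_const (by norm_num : (0 : ℝ) < 6),
    t3.eventually_lt_const (by norm_num : (0 : ℝ) < 1 / 2)] with x hx a1 a2 a3
  refine ⟨hx, a1, ?_, ?_⟩
  · linarith
  · linarith

lemma sqrt_two_pi_mul_pow_le {l x B : ℝ} {D : ℕ} (hl : 0 ≤ l) (hx : 1 ≤ x) (hlx : 2 * l ≤ x)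
    (hD : (D : ℝ) ≤ B) :
    √((2 * Real.pi * l) ^ D) ≤ Real.exp ((Real.log x + 2) * B) := by
  have hx0 : 0 < x := by linarith
  have hL := Real.log_nonneg hx
  have hpi := Real.pi_pos
  have h1 : 2 * Real.pi * l ≤ Real.exp (2 * (Real.log x + 2)) := by
    have e1 : Real.exp (2 * (Real.log x + 2)) = x * (x * Real.exp 4) := by
      rw [show 2 * (Real.log x + 2) = Real.log x + (Real.log x + 4) by ring, Real.exp_add,
        Real.exp_add, Real.exp_log hx0]
    have e2 : 4 ≤ Real.exp 4 := by linarith [Real.add_one_le_exp (4 : ℝ)]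
    have e3 : 4 ≤ x * Real.exp 4 := e2.trans (le_mul_of_one_le_left (Real.exp_pos 4).le hx)
    calc 2 * Real.pi * l = (2 * l) * Real.pi := by ring
      _ ≤ x * 4 := mul_le_mul hlx Real.pi_le_four hpi.le hx0.le
      _ ≤ x * (x * Real.exp 4) := by gcongr
      _ = _ := e1.symm
  rw [Real.sqrt_le_left (Real.exp_pos _).le]
  calc (2 * Real.pi * l) ^ D ≤ Real.exp (2 * (Real.log x + 2)) ^ D := by gcongr
    _ = Real.exp (D * (2 * (Real.log x + 2))) := (Real.exp_nat_mul _ _).symm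
    _ ≤ Real.exp (B * (2 * (Real.log x + 2))) := Real.exp_le_exp.2 (by gcongr)
    _ = Real.exp ((Real.log x + 2) * B) ^ 2 := by rw [← Real.exp_nat_mul]; push_cast; ring_nf

/-- For radius `x ^ (-s)`, the cubic error needs `1 - 3 * s < 0` and the far bound needs `1 - 2 * s
> 1 / 6`, so `1/3 < s < 5/12`; the choice `s = 2/5` leaves the margin `1/5 - 1/6 = 1/30`. -/
lemma abs_div_mainTerm_sub_one_le_errorBound {g k lam : ℕ} [NeZero g] (hg : 2 ≤ g) (hk : 1 ≤ k)
    (hlam : 0 < lam) (heven : Even g → Even lam)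
    (hgk : (k : ℝ) * Real.log g ≤ 1 / 6 * Real.log ((lam : ℝ) * g))
    (hx : 1 ≤ (lam : ℝ) * g)
    (hδg : 2 * (g : ℝ) * ((lam : ℝ) * g) ^ (-(2 / 5) : ℝ) < 1)
    (hδK : ((lam : ℝ) * g) ^ (-(2 / 5) : ℝ) * (1 + 6 * g * Real.log ((lam : ℝ) * g) ^ 2) < 6)
    (hδ : 2 * Real.pi * (g * Real.log ((lam : ℝ) * g) ^ 2 * ((lam : ℝ) * g) ^ (-(2 / 5) : ℝ))
      ≤ 1 / 2) :
    |(numDifferenceMatrices g k lam : ℝ) / mainTerm g k lam - 1|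
      ≤ errorBound g ((lam : ℝ) * g) := by
  have hg2 : (2 : ℝ) ≤ g := by exact_mod_cast hg
  have hl : (0 : ℝ) < lam := by exact_mod_cast hlam
  have hpi := Real.pi_pos
  have hN : ((g * lam : ℕ) : ℝ) = (lam : ℝ) * g := by push_cast; ring
  set x : ℝ := (lam : ℝ) * g with hxdef
  have hx0 : 0 < x := by linarith
  set L := Real.log x with hL
  have hL0 : 0 ≤ L := Real.log_nonneg hx
  -- `log g ≥ log 2 > 1 / 6` turns the growth condition into `k ≤ L`, so the dimension is at most `g
  -- * L ^ 2`.
  have hkL : (k : ℝ) ≤ L := by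
    have h1 : Real.log 2 ≤ Real.log g := Real.log_le_log (by norm_num) hg2
    have h2 := Real.log_two_gt_d9
    have h3 : (0 : ℝ) ≤ k := Nat.cast_nonneg _
    nlinarith
  have hchoose : (k.choose 2 : ℝ) ≤ L ^ 2 := by
    have h3 : (1 : ℝ) ≤ k := by exact_mod_cast hk
    rw [Nat.cast_choose_two]
    nlinarith
  have hD : ((k.choose 2 * (g - 1) : ℕ) : ℝ) ≤ g * L ^ 2 := by
    rw [Nat.cast_mul, Nat.cast_sub (by omega), Nat.cast_one, mul_comm]
    gcongr
    linarith
  have hgk' : (g : ℝ) ^ k ≤ x ^ (1 / 6 : ℝ) := by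
    rw [← Real.rpow_natCast, ← Real.log_le_log_iff (by positivity) (by positivity),
      Real.log_rpow (by linarith), Real.log_rpow hx0]
    exact hgk
  set δ := x ^ (-(2 / 5) : ℝ) with hδdef
  have hδ0 : 0 < δ := Real.rpow_pos_of_pos hx0 _
  set D := k.choose 2 * (g - 1) with hDdef
  refine (abs_div_mainTerm_sub_one_le (δ := δ) hg hk hlam heven hδ0.le hδg
    (lt_of_le_of_lt ?_ hδK) (le_trans ?_ hδ)).trans ?_
  · gcongr
  · gcongr
  have hδ2 : δ ^ 2 = x ^ (-(4 / 5) : ℝ) := by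
    rw [hδdef, ← Real.rpow_natCast, ← Real.rpow_mul hx0.le]; norm_num
  have hδ3 : x * δ ^ 3 = x ^ (-(1 / 5) : ℝ) := by
    rw [hδdef, ← Real.rpow_natCast, ← Real.rpow_mul hx0.le]
    nth_rewrite 1 [← Real.rpow_one x]
    rw [← Real.rpow_add hx0]; norm_num
  have hxδ2 : x * δ ^ 2 = x ^ (1 / 5 : ℝ) := by
    rw [hδ2]
    nth_rewrite 1 [← Real.rpow_one x]
    rw [← Real.rpow_add hx0]; norm_num
  unfold errorBound
  refine add_le_add (add_le_add (sub_le_sub_right (Real.exp_le_exp.2 ?_) _) ?_) ?_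
  · rw [hN, ← hL, ← hδ3]
    calc x * (2 * (2 * Real.pi * (D * δ)) ^ 3)
        ≤ x * (2 * (2 * Real.pi * (g * L ^ 2 * δ)) ^ 3) := by gcongr
      _ = _ := by ring
  · have hs : √2 ^ D ≤ Real.exp (g * L ^ 2) := by
      have h1 : √2 ≤ Real.exp 1 := by
        rw [Real.sqrt_le_left (Real.exp_pos 1).le]
        have := Real.add_one_le_exp (1 : ℝ)
        nlinarith
      calc √2 ^ D ≤ Real.exp 1 ^ D := by gcongr
        _ = Real.exp (D * 1) := (Real.exp_nat_mul _ _).symm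
        _ ≤ _ := by rw [mul_one]; exact Real.exp_le_exp.2 hD
    calc _ ≤ Real.exp (-(Real.pi ^ 2 * lam * (δ ^ 2 / g))) * Real.exp (g * L ^ 2) := by gcongr
      _ = _ := by
        rw [← Real.exp_add, ← hxδ2, hxdef]
        congr 1
        field_simp
        ring
  · have hs : √((2 * Real.pi * lam) ^ D) ≤ Real.exp ((L + 2) * (g * L ^ 2)) :=
      sqrt_two_pi_mul_pow_le hl.le hx (by rw [hxdef]; nlinarith) hD
    have ht : 1 / (9 * (g : ℝ) ^ 2) * x ^ (1 / 30 : ℝ) ≤ x * (δ ^ 2 / (9 * g ^ 2 * g ^ k)) := by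
      have h1 : x ^ (1 / 30 : ℝ) * (g : ℝ) ^ k ≤ x * δ ^ 2 := by
        calc _ ≤ x ^ (1 / 30 : ℝ) * x ^ (1 / 6 : ℝ) := by gcongr
          _ = x * δ ^ 2 := by rw [hxδ2, ← Real.rpow_add hx0]; norm_num
      rw [mul_div_assoc', le_div_iff₀ (by positivity)]
      calc _ = x ^ (1 / 30 : ℝ) * (g : ℝ) ^ k := by field_simp
        _ ≤ _ := h1
    calc _ ≤ Real.exp ((L + 2) * (g * L ^ 2)) *
          Real.exp (-(1 / (9 * (g : ℝ) ^ 2) * x ^ (1 / 30 : ℝ))) := by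
          rw [hN]
          gcongr
      _ = _ := by
        rw [← Real.exp_add]
        congr 1
        ring

theorem theorem1 (g : ℕ) (hg : 2 ≤ g) (k lam : ℕ → ℕ)
    (hk : ∀ n, 3 ≤ k n)
    (hlam : Filter.Tendsto lam Filter.atTop Filter.atTop)
    (heven : Even g → ∀ n, Even (lam n))
    (hgrowth : ∃ ε₀ : ℝ, 0 < ε₀ ∧ ∀ n,
      (k n : ℝ) < (1 / 6 - ε₀) * (Real.log ((lam n : ℝ) * (g : ℝ)) / Real.log (g : ℝ))) :
    ∃ e : ℕ → ℝ, Filter.Tendsto e Filter.atTop (nhds 0) ∧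
      ∀ n, (numDifferenceMatrices g (k n) (lam n) : ℝ) =
        (g : ℝ) ^ ((k n : ℝ) * (lam n : ℝ) * (g : ℝ)
            + (3 * (k n : ℝ) - 4) * ((k n : ℝ) - 1) / 4)
          / Real.sqrt ((2 * Real.pi * (lam n : ℝ)) ^ ((k n).choose 2 * (g - 1)))
          * (1 + e n) := by
  have : NeZero g := ⟨by omega⟩
  have hg2 : (2 : ℝ) ≤ g := by exact_mod_cast hg
  have hpi := Real.pi_pos
  obtain ⟨ε, hε, hkε⟩ := hgrowth
  have hlogg : 0 < Real.log g := Real.log_pos (by linarith)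
  -- If `lam n = 0`, then `Real.log 0 = 0` makes the growth bound read `k n < 0`.
  have hlam0 : ∀ n, 0 < lam n := by
    intro n
    by_contra! h0
    have h1 := hkε n
    rw [Nat.le_zero.1 h0] at h1
    have h2 : (0 : ℝ) ≤ k n := Nat.cast_nonneg _
    simp at h1
    linarith
  have hgk : ∀ n, (k n : ℝ) * Real.log g ≤ 1 / 6 * Real.log ((lam n : ℝ) * g) := by
    intro n
    have h1 := hkε n
    have h2 : (1 : ℝ) ≤ lam n := by exact_mod_cast hlam0 n
    have h3 : 0 ≤ Real.log ((lam n : ℝ) * g) := Real.log_nonneg (by nlinarith)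
    rw [mul_div_assoc', lt_div_iff₀ hlogg] at h1
    nlinarith
  have hM : ∀ n, 0 < mainTerm g (k n) (lam n) := by
    intro n
    have : (0 : ℝ) < lam n := by exact_mod_cast hlam0 n
    unfold mainTerm
    positivity
  refine ⟨fun n => numDifferenceMatrices g (k n) (lam n) / mainTerm g (k n) (lam n) - 1, ?_,
    fun n => ?_⟩
  · have hxt : Filter.Tendsto (fun n => (lam n : ℝ) * g) Filter.atTop Filter.atTop :=
      (tendsto_natCast_atTop_atTop.comp hlam).atTop_mul_const (by linarith)
    refine squeeze_zero_norm' ?_ ((tendsto_errorBound (g := g) (by linarith)).comp hxt)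
    filter_upwards [hxt.eventually (eventually_small_radius (g := g))] with n hn
    exact abs_div_mainTerm_sub_one_le_errorBound hg (by linarith [hk n]) (hlam0 n)
      (fun h => heven h n) (hgk n) hn.1 hn.2.1 hn.2.2.1 hn.2.2.2
  · change _ = mainTerm g (k n) (lam n) * _
    rw [add_sub_cancel, mul_div_cancel₀ _ (hM n).ne']
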